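/- Notation. Let $\mathcal G(\mathbb R)=\mathcal E_M(\mathbb R)/\mathcal N(\mathbb R)$ be the (special) Colombeau algebra on $\mathbb R$, where $\mathcal E_M(\mathbb R)$ (resp. $\mathcal N(\mathbb R)$) consists of the nets $(w_\varepsilon)_{\varepsilon\in(0,1)}$ of smooth functions on $\mathbb R$ each of whose derivatives is, uniformly on compact sets, $O(\varepsilon^{-N})$ for some $N$ (resp. $O(\varepsilon^{M})$ for all $M$) as $\varepsilon\to0$. Initial values are taken in the corresponding ring of generalized numbers, which contains $\mathbb R$. For $w\in\mathcal G(\mathbb R)$ and a distribution $T\in\mathcal D'(\mathbb R)$ write $w\approx T$ if $\int w_\varepsilon\varphi\,du\to T(\varphi)$ as $\varepsilon\to0$ for every test function $\varphi$. A generalized delta function is an element $\rho$ of $\mathcal G(\mathbb R)$ with a representative such that $\operatorname{supp}\rho_\varepsilon\subseteq[-\varepsilon,\varepsilon]$ for all $\varepsilon$, $\int\rho_\varepsilon\to1$, and $\int|\rho_\varepsilon|$ is bounded for small $\varepsilon$. A generalized function is locally bounded if it has a representative that is bounded on each compact set uniformly for small $\varepsilon$. Let $\theta$ be the step function, $u_+=\theta(u)u$,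 and let $\dot{}$ denote $d/du$. Setting. Let $F:\mathbb R^2\to\mathbb R$ be smooth and depend only on $x^2+y^2$, put $f(r)=F(r,0)$ with derivatives $f',f''$, and let $\rho$ be a generalized delta function. Let $(v,x,y)\in\mathcal G(\mathbb R)^3$ be locally bounded and solve the geodesic equation of the regularized pp-wave metric $F(x,y)\rho(u)\,du^2-du\,dv+dx^2+dy^2$, $$\ddot v=F(x,y)\dot\rho+2\big(\partial_xF(x,y)\dot x+\partial_yF(x,y)\dot y\big)\rho,\quad \ddot x=\tfrac12\partial_xF(x,y)\rho,\quad \ddot y=\tfrac12\partial_yF(x,y)\rho$$ with $v(-1)=0$, $\dot v(-1)=\dot v_0\in\mathbb R$, $x(-1)=x_0\in\mathbb R$, $\dot x(-1)=0$, $y(-1)=\dot y(-1)=0$. Consider the Jacobi equation in $\mathcal G(\mathbb R)$ for $N=(N^u,N^v,N^x,N^y)$ along this geodesic: $$\ddot N^u=0,\qquad \ddot N^y=0,\qquad \ddot N^x=\big[\dot N^uf'(x)+\tfrac12N^xf''(x)\big]\rho+\tfrac12f'(x)N^u\dot\rho,$$ $$\ddot N^v=2\big[N^xf'(x)\rho\big]^{\cdot}-N^xf'(x)\dot\rho+\big[N^uf(x)\rho\big]^{\cdot\cdot}-N^uf''(x)\dot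 x^2\rho-N^uf'(x)\ddot x\,\rho .$$ Theorem. (i) For arbitrary initial data $N(-1)=n$, $\dot N(-1)=\dot n$ the Jacobi equation has a unique solution in $\mathcal G(\mathbb R)^4$. (ii) For $a,b\in\mathbb R$, the solution with $N(-1)=0$, $\dot N(-1)=(a,b,0,0)$ satisfies $$N^x\approx\tfrac12af'(x_0)(u_++\theta),\qquad N^v\approx b(1+u)+a\big[f(x_0)\delta+\tfrac14f'(x_0)^2(\theta+u_+)\big].$$ (iii) For $a\in\mathbb R$, the solution with $N(-1)=(0,0,a,0)$, $\dot N(-1)=0$ satisfies $$N^x\approx a\big(1+\tfrac12f''(x_0)u_+\big),\qquad N^v\approx af'(x_0)\big(\theta+\tfrac12f''(x_0)u_+\big).$$ -/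

import Mathlib

open Filter Topology MeasureTheory
open scoped ContDiff Distributions

namespace Colombeau

/-! ### Nets and asymptotics -/

/-- The regularization parameter ranges over the open interval `(0,1)`. -/
abbrev Param : Type := Set.Ioo (0 : ℝ) 1

/-- The filter on `(0,1)` describing `ε → 0`. -/
def toZero : Filter Param := comap (fun ε : Param => (ε : ℝ)) (𝓝 0)

/-- `sup_{t ∈ K} |w_ε(t)| = O(ε^{-N})` as `ε → 0`, for some `N`. -/
def ModerateOn {α : Type*} (K : Set α) (w : Param → α → ℝ) : Prop :=
  ∃ N : ℕ, ∃ C : ℝ, ∀ᶠ ε in toZero, ∀ t ∈ K, |w ε t| ≤ C * ((ε : ℝ) ^ N)⁻¹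

/-- `sup_{t ∈ K} |w_ε(t)| = O(ε^M)` as `ε → 0`, for every `M`. -/
def NegligibleOn {α : Type*} (K : Set α) (w : Param → α → ℝ) : Prop :=
  ∀ M : ℕ, ∃ C : ℝ, ∀ᶠ ε in toZero, ∀ t ∈ K, |w ε t| ≤ C * (ε : ℝ) ^ M

section Asymptotics

variable {α : Type*} {K : Set α} {p q : Param → α → ℝ}

theorem moderateOn_of_bounded (C : ℝ) (h : ∀ᶠ ε in toZero, ∀ t ∈ K, |p ε t| ≤ C) :
    ModerateOn K p :=
  ⟨0, C, by simpa using h⟩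

theorem ModerateOn.exists_nonneg (hp : ModerateOn K p) :
    ∃ N : ℕ, ∃ C : ℝ, 0 ≤ C ∧ ∀ᶠ ε in toZero, ∀ t ∈ K, |p ε t| ≤ C * ((ε : ℝ) ^ N)⁻¹ := by
  obtain ⟨N, C, h⟩ := hp
  refine ⟨N, |C|, abs_nonneg C, h.mono fun ε hε t ht => (hε t ht).trans ?_⟩
  have h0 : (0 : ℝ) < ε := ε.2.1
  exact mul_le_mul_of_nonneg_right (le_abs_self C) (by positivity)

theorem NegligibleOn.exists_nonneg (hp : NegligibleOn K p) (M : ℕ) :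
    ∃ C : ℝ, 0 ≤ C ∧ ∀ᶠ ε in toZero, ∀ t ∈ K, |p ε t| ≤ C * (ε : ℝ) ^ M := by
  obtain ⟨C, h⟩ := hp M
  refine ⟨|C|, abs_nonneg C, h.mono fun ε hε t ht => (hε t ht).trans ?_⟩
  have h0 : (0 : ℝ) < ε := ε.2.1
  exact mul_le_mul_of_nonneg_right (le_abs_self C) (by positivity)

theorem ModerateOn.add (hp : ModerateOn K p) (hq : ModerateOn K q) :
    ModerateOn K (fun ε t => p ε t + q ε t) := by
  obtain ⟨N, C, hC, h⟩ := hp.exists_nonneg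
  obtain ⟨N', C', hC', h'⟩ := hq.exists_nonneg
  refine ⟨N + N', C + C', ?_⟩
  filter_upwards [h, h'] with ε h1 h2 t ht
  have h0 : (0 : ℝ) < ε := ε.2.1
  have hle : (ε : ℝ) ≤ 1 := ε.2.2.le
  have e1 : ((ε : ℝ) ^ N)⁻¹ ≤ ((ε : ℝ) ^ (N + N'))⁻¹ :=
    inv_anti₀ (by positivity) (pow_le_pow_of_le_one h0.le hle (by omega))
  have e2 : ((ε : ℝ) ^ N')⁻¹ ≤ ((ε : ℝ) ^ (N + N'))⁻¹ :=
    inv_anti₀ (by positivity) (pow_le_pow_of_le_one h0.le hle (by omega))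
  calc |p ε t + q ε t| ≤ |p ε t| + |q ε t| := abs_add_le _ _
    _ ≤ C * ((ε : ℝ) ^ N)⁻¹ + C' * ((ε : ℝ) ^ N')⁻¹ := add_le_add (h1 t ht) (h2 t ht)
    _ ≤ C * ((ε : ℝ) ^ (N + N'))⁻¹ + C' * ((ε : ℝ) ^ (N + N'))⁻¹ := by gcongr
    _ = _ := by ring

theorem ModerateOn.mul (hp : ModerateOn K p) (hq : ModerateOn K q) :
    ModerateOn K (fun ε t => p ε t * q ε t) := by
  obtain ⟨N, C, hC, h⟩ := hp.exists_nonneg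
  obtain ⟨N', C', hC', h'⟩ := hq.exists_nonneg
  refine ⟨N + N', C * C', ?_⟩
  filter_upwards [h, h'] with ε h1 h2 t ht
  have h0 : (0 : ℝ) < ε := ε.2.1
  rw [abs_mul]
  calc |p ε t| * |q ε t| ≤ (C * ((ε : ℝ) ^ N)⁻¹) * (C' * ((ε : ℝ) ^ N')⁻¹) :=
        mul_le_mul (h1 t ht) (h2 t ht) (abs_nonneg _) (by positivity)
    _ = _ := by rw [pow_add, mul_inv]; ring

theorem ModerateOn.const (c : ℝ) : ModerateOn K (fun _ _ => c) :=
  moderateOn_of_bounded |c| (by simp)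

theorem ModerateOn.sum {ι : Type*} (s : Finset ι) {f : ι → Param → α → ℝ}
    (h : ∀ i ∈ s, ModerateOn K (f i)) : ModerateOn K (fun ε t => ∑ i ∈ s, f i ε t) := by
  classical
  induction s using Finset.induction_on with
  | empty => simpa using ModerateOn.const (K := K) 0
  | insert a s ha ih =>
    simp only [Finset.sum_insert ha]
    exact (h a (by simp)).add (ih fun i hi => h i (by simp [hi]))

theorem NegligibleOn.add (hp : NegligibleOn K p) (hq : NegligibleOn K q) :
    NegligibleOn K (fun ε t => p ε t + q ε t) := by
  intro M
  obtain ⟨C, h⟩ := hp M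
  obtain ⟨C', h'⟩ := hq M
  refine ⟨C + C', ?_⟩
  filter_upwards [h, h'] with ε h1 h2 t ht
  calc |p ε t + q ε t| ≤ |p ε t| + |q ε t| := abs_add_le _ _
    _ ≤ C * (ε : ℝ) ^ M + C' * (ε : ℝ) ^ M := add_le_add (h1 t ht) (h2 t ht)
    _ = _ := by ring

theorem NegligibleOn.mul_moderate (hp : NegligibleOn K p) (hq : ModerateOn K q) :
    NegligibleOn K (fun ε t => p ε t * q ε t) := by
  intro M
  obtain ⟨N, C', hC', h'⟩ := hq.exists_nonneg
  obtain ⟨C, hC, h⟩ := hp.exists_nonneg (M + N)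
  refine ⟨C * C', ?_⟩
  filter_upwards [h, h'] with ε h1 h2 t ht
  have h0 : (0 : ℝ) < ε := ε.2.1
  rw [abs_mul]
  calc |p ε t| * |q ε t| ≤ (C * (ε : ℝ) ^ (M + N)) * (C' * ((ε : ℝ) ^ N)⁻¹) :=
        mul_le_mul (h1 t ht) (h2 t ht) (abs_nonneg _) (by positivity)
    _ = C * C' * (ε : ℝ) ^ M := by rw [pow_add]; field_simp

theorem NegligibleOn.zero : NegligibleOn K (fun _ _ => (0 : ℝ)) :=
  fun _ => ⟨0, by simp⟩

theorem NegligibleOn.sum {ι : Type*} (s : Finset ι) {f : ι → Param → α → ℝ}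
    (h : ∀ i ∈ s, NegligibleOn K (f i)) : NegligibleOn K (fun ε t => ∑ i ∈ s, f i ε t) := by
  classical
  induction s using Finset.induction_on with
  | empty => simpa using NegligibleOn.zero (K := K)
  | insert a s ha ih =>
    simp only [Finset.sum_insert ha]
    exact (h a (by simp)).add (ih fun i hi => h i (by simp [hi]))

end Asymptotics

/-! ### The algebra `G(ℝ)` -/

/-- Membership in `E_M(ℝ)`: a net of smooth functions all of whose derivatives are
`O(ε^{-N})` uniformly on compact sets. -/
def IsModerate (u : Param → ℝ → ℝ) : Prop :=
  (∀ ε, ContDiff ℝ ∞ (u ε)) ∧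
    ∀ K : Set ℝ, IsCompact K → ∀ n : ℕ, ModerateOn K (fun ε t => iteratedDeriv n (u ε) t)

/-- The defining estimates of `N(ℝ)`: all derivatives are `O(ε^M)` for all `M`, uniformly on
compact sets. -/
def IsNegligible (u : Param → ℝ → ℝ) : Prop :=
  ∀ K : Set ℝ, IsCompact K → ∀ n : ℕ, NegligibleOn K (fun ε t => iteratedDeriv n (u ε) t)

section Leibniz

variable {u w : Param → ℝ → ℝ} {K : Set ℝ}

theorem moderateOn_iteratedDeriv_mul (hu : ∀ ε, ContDiff ℝ ∞ (u ε))
    (hw : ∀ ε, ContDiff ℝ ∞ (w ε)) (n : ℕ)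
    (mu : ∀ i ≤ n, ModerateOn K (fun ε t => iteratedDeriv i (u ε) t))
    (mw : ∀ i ≤ n, ModerateOn K (fun ε t => iteratedDeriv i (w ε) t)) :
    ModerateOn K (fun ε t => iteratedDeriv n (fun s => u ε s * w ε s) t) := by
  have e : (fun (ε : Param) (t : ℝ) => iteratedDeriv n (fun s => u ε s * w ε s) t) =
      fun ε t => ∑ i ∈ Finset.range (n + 1),
        (n.choose i : ℝ) * iteratedDeriv i (u ε) t * iteratedDeriv (n - i) (w ε) t := by
    funext ε t
    exact iteratedDeriv_fun_mul ((hu ε).contDiffAt.of_le (by exact_mod_cast le_top))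
      ((hw ε).contDiffAt.of_le (by exact_mod_cast le_top))
  rw [e]
  refine ModerateOn.sum _ fun i hi => ?_
  have hi' : i ≤ n := by simpa [Nat.lt_succ_iff] using hi
  exact ((ModerateOn.const _).mul (mu i hi')).mul (mw _ (Nat.sub_le _ _))

theorem negligibleOn_iteratedDeriv_mul (hu : ∀ ε, ContDiff ℝ ∞ (u ε))
    (hw : ∀ ε, ContDiff ℝ ∞ (w ε)) (n : ℕ)
    (mu : ∀ i ≤ n, NegligibleOn K (fun ε t => iteratedDeriv i (u ε) t))
    (mw : ∀ i ≤ n, ModerateOn K (fun ε t => iteratedDeriv i (w ε) t)) :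
    NegligibleOn K (fun ε t => iteratedDeriv n (fun s => u ε s * w ε s) t) := by
  have e : (fun (ε : Param) (t : ℝ) => iteratedDeriv n (fun s => u ε s * w ε s) t) =
      fun ε t => ∑ i ∈ Finset.range (n + 1),
        iteratedDeriv i (u ε) t * ((n.choose i : ℝ) * iteratedDeriv (n - i) (w ε) t) := by
    funext ε t
    rw [iteratedDeriv_fun_mul ((hu ε).contDiffAt.of_le (by exact_mod_cast le_top))
      ((hw ε).contDiffAt.of_le (by exact_mod_cast le_top))]
    exact Finset.sum_congr rfl fun i _ => by ring
  rw [e]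
  refine NegligibleOn.sum _ fun i hi => ?_
  have hi' : i ≤ n := by simpa [Nat.lt_succ_iff] using hi
  exact (mu i hi').mul_moderate ((ModerateOn.const _).mul (mw _ (Nat.sub_le _ _)))

theorem iteratedDeriv_fun_add_smooth {f g : ℝ → ℝ} (hf : ContDiff ℝ ∞ f) (hg : ContDiff ℝ ∞ g)
    (n : ℕ) (t : ℝ) : iteratedDeriv n (fun s => f s + g s) t =
      iteratedDeriv n f t + iteratedDeriv n g t :=
  iteratedDeriv_fun_add (hf.contDiffAt.of_le (by exact_mod_cast le_top))
    (hg.contDiffAt.of_le (by exact_mod_cast le_top))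

end Leibniz

/-- The differential algebra `E_M(ℝ)` of moderate nets, with pointwise operations. -/
def moderateNets : Subalgebra ℝ (Param → ℝ → ℝ) where
  carrier := {u | IsModerate u}
  mul_mem' {u w} hu hw := ⟨fun ε => (hu.1 ε).mul (hw.1 ε), fun K hK n =>
    moderateOn_iteratedDeriv_mul hu.1 hw.1 n (fun i _ => hu.2 K hK i) fun i _ => hw.2 K hK i⟩
  add_mem' {u w} hu hw := ⟨fun ε => (hu.1 ε).add (hw.1 ε), fun K hK n => by
    have e := fun (ε : Param) (t : ℝ) => iteratedDeriv_fun_add_smooth (hu.1 ε) (hw.1 ε) n t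
    have h := (hu.2 K hK n).add (hw.2 K hK n)
    simp only [← e] at h
    exact h⟩
  algebraMap_mem' c := ⟨fun _ => contDiff_const, fun K _ n => by
    have e : (fun (ε : Param) (t : ℝ) =>
        iteratedDeriv n ((algebraMap ℝ (Param → ℝ → ℝ) c) ε) t) =
        fun _ _ => if n = 0 then c else 0 := by
      funext ε t
      exact iteratedDeriv_const
    rw [e]
    exact ModerateOn.const _⟩

theorem moderateNets_prop (u : moderateNets) : IsModerate u.1 := u.2

/-- The ideal `N(ℝ)` of negligible nets. -/
def negligibleNets : Ideal moderateNets where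
  carrier := {u | IsNegligible u.1}
  zero_mem' := fun K _ n => by
    have e : (fun (ε : Param) (t : ℝ) => iteratedDeriv n ((0 : moderateNets).1 ε) t) =
        fun _ _ => 0 := by
      funext ε t
      have : ((0 : moderateNets).1 ε) = fun _ : ℝ => (0 : ℝ) := rfl
      rw [this, iteratedDeriv_const]
      simp
    rw [e]
    exact NegligibleOn.zero
  add_mem' {u w} hu hw := fun K hK n => by
    have e := fun (ε : Param) (t : ℝ) => iteratedDeriv_fun_add_smooth
      ((moderateNets_prop u).1 ε) ((moderateNets_prop w).1 ε) n t
    have h := (hu K hK n).add (hw K hK n)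
    simp only [← e] at h
    exact h
  smul_mem' c u hu := fun K hK n => by
    have h := negligibleOn_iteratedDeriv_mul (moderateNets_prop u).1 (moderateNets_prop c).1 n
      (fun i _ => hu K hK i) (fun i _ => (moderateNets_prop c).2 K hK i)
    simp only [mul_comm] at h
    exact h

/-- The Colombeau algebra `G(ℝ) = E_M(ℝ) / N(ℝ)`. -/
abbrev GenFun : Type := moderateNets ⧸ negligibleNets

/-- The class in `G(ℝ)` of a moderate net. -/
abbrev GenFun.mk (u : moderateNets) : GenFun := Ideal.Quotient.mk negligibleNets u

theorem GenFun.mk_eq_iff (u w : moderateNets) :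
    GenFun.mk u = GenFun.mk w ↔ IsNegligible (fun ε t => u.1 ε t - w.1 ε t) :=
  Ideal.Quotient.eq

/-! ### Derivative -/

/-- The derivative of a moderate net, taken for each parameter. -/
noncomputable def derivNet (u : moderateNets) : moderateNets :=
  ⟨fun ε => deriv (u.1 ε), fun ε => ((contDiff_infty_iff_deriv).1 (u.2.1 ε)).2,
    fun K hK n => by
      have h := u.2.2 K hK (n + 1)
      simp only [iteratedDeriv_succ'] at h
      exact h⟩

theorem deriv_fun_sub_net (u w : moderateNets) (ε : Param) :
    deriv (fun t => u.1 ε t - w.1 ε t) = fun t => deriv (u.1 ε) t - deriv (w.1 ε) t := by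
  funext t
  exact deriv_fun_sub (((moderateNets_prop u).1 ε).differentiable (by simp) t)
    (((moderateNets_prop w).1 ε).differentiable (by simp) t)

/-- The derivation `u ↦ u̇` of `G(ℝ)`. -/
noncomputable def GenFun.D : GenFun → GenFun :=
  Quotient.lift (fun u => GenFun.mk (derivNet u)) fun u w h => by
    have h' : GenFun.mk u = GenFun.mk w := Quotient.sound h
    rw [GenFun.mk_eq_iff] at h' ⊢
    intro K hK n
    have := h' K hK (n + 1)
    simp only [iteratedDeriv_succ', deriv_fun_sub_net] at this
    exact this

theorem GenFun.D_mk (u : moderateNets) : GenFun.D (GenFun.mk u) = GenFun.mk (derivNet u) := rfl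

/-! ### Generalized numbers and point values -/

/-- Moderate nets of real numbers. -/
def moderateNumbers : Subalgebra ℝ (Param → ℝ) where
  carrier := {r | ModerateOn (Set.univ : Set Unit) (fun ε _ => r ε)}
  mul_mem' hr hs := ModerateOn.mul hr hs
  add_mem' hr hs := ModerateOn.add hr hs
  algebraMap_mem' c := ModerateOn.const c

/-- The ideal of negligible nets of real numbers. -/
def negligibleNumbers : Ideal moderateNumbers where
  carrier := {r | NegligibleOn (Set.univ : Set Unit) (fun ε _ => r.1 ε)}
  zero_mem' := NegligibleOn.zero
  add_mem' hr hs := NegligibleOn.add hr hs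
  smul_mem' c r hr := by
    have h := NegligibleOn.mul_moderate hr c.2
    simp only [mul_comm] at h
    exact h

/-- The ring of (real) generalized numbers. It is an `ℝ`-algebra; a real number `c` is identified
with the class of the constant net, `algebraMap ℝ GenNum c`. -/
abbrev GenNum : Type := moderateNumbers ⧸ negligibleNumbers

/-- The class of a moderate net of numbers. -/
abbrev GenNum.mk (r : moderateNumbers) : GenNum := Ideal.Quotient.mk negligibleNumbers r

theorem GenNum.mk_eq_iff (r s : moderateNumbers) :
    GenNum.mk r = GenNum.mk s ↔
      NegligibleOn (Set.univ : Set Unit) (fun ε _ => r.1 ε - s.1 ε) :=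
  Ideal.Quotient.eq

/-- The net of values of a moderate net at the point `t`. -/
def evalNet (t : ℝ) (u : moderateNets) : moderateNumbers :=
  ⟨fun ε => u.1 ε t, by
    obtain ⟨N, C, h⟩ := u.2.2 {t} isCompact_singleton 0
    exact ⟨N, C, h.mono fun ε hε _ _ => by simpa using hε⟩⟩

/-- The value of a generalized function at the point `t`, a generalized number. -/
def GenFun.at (g : GenFun) (t : ℝ) : GenNum :=
  Quotient.lift (fun u => GenNum.mk (evalNet t u)) (fun u w h => by
    have h' : GenFun.mk u = GenFun.mk w := Quotient.sound h
    rw [GenFun.mk_eq_iff] at h'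
    rw [GenNum.mk_eq_iff]
    intro M
    obtain ⟨C, hC⟩ := h' {t} isCompact_singleton 0 M
    exact ⟨C, hC.mono fun ε hε _ _ => by simpa [evalNet] using hε⟩) g

theorem GenFun.at_mk (u : moderateNets) (t : ℝ) :
    (GenFun.mk u).at t = GenNum.mk (evalNet t u) := rfl

/-! ### Composition of smooth functions with locally bounded generalized functions -/

/-- A net is locally bounded if on each compact set it is bounded uniformly for small `ε`. -/
def LocallyBoundedNet (u : Param → ℝ → ℝ) : Prop :=
  ∀ K : Set ℝ, IsCompact K → ∃ C : ℝ, ∀ᶠ ε in toZero, ∀ t ∈ K, |u ε t| ≤ C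

/-- A generalized function is locally bounded if it has a locally bounded representative
(equivalently, by `LocallyBounded.of_mk`, if all its representatives are locally bounded). -/
def LocallyBounded (g : GenFun) : Prop :=
  ∃ u : moderateNets, GenFun.mk u = g ∧ LocallyBoundedNet u.1

theorem LocallyBounded.of_mk {u : moderateNets} (h : LocallyBounded (GenFun.mk u)) :
    LocallyBoundedNet u.1 := by
  obtain ⟨w, hw, hb⟩ := h
  rw [GenFun.mk_eq_iff] at hw
  intro K hK
  obtain ⟨C, hC⟩ := hb K hK
  obtain ⟨C', hC'⟩ := hw K hK 0 0
  refine ⟨C + C', ?_⟩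
  filter_upwards [hC, hC'] with ε h1 h2 t ht
  have a1 := h1 t ht
  have a2 := h2 t ht
  simp only [iteratedDeriv_zero, pow_zero, mul_one] at a2
  rw [abs_le] at *
  constructor <;> linarith [a1.1, a1.2, a2.1, a2.2]

/-- The locally bounded elements of `G(ℝ)`. -/
abbrev LBGenFun : Type := {g : GenFun // LocallyBounded g}

/-- Smooth functions on the plane with coordinates `(x, y)`. -/
abbrev SmoothPlane : Type := {F : ℝ × ℝ → ℝ // ContDiff ℝ ∞ F}

/-- Smooth functions on the line. -/
abbrev SmoothLine : Type := {f : ℝ → ℝ // ContDiff ℝ ∞ f}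

/-- The partial derivative with respect to `x`. -/
noncomputable def SmoothPlane.dx (F : SmoothPlane) : SmoothPlane :=
  ⟨fun p => fderiv ℝ F.1 p (1, 0),
    (F.2.fderiv_right (m := ∞) (by simp)).clm_apply contDiff_const⟩

/-- The partial derivative with respect to `y`. -/
noncomputable def SmoothPlane.dy (F : SmoothPlane) : SmoothPlane :=
  ⟨fun p => fderiv ℝ F.1 p (0, 1),
    (F.2.fderiv_right (m := ∞) (by simp)).clm_apply contDiff_const⟩

/-- The derivative of a smooth function on the line. -/
noncomputable def SmoothLine.d (f : SmoothLine) : SmoothLine :=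
  ⟨deriv f.1, (contDiff_infty_iff_deriv.1 f.2).2⟩

section Composition

variable {u w u' w' : Param → ℝ → ℝ}

theorem contDiff_comp_pair (F : SmoothPlane) {f g : ℝ → ℝ} (hf : ContDiff ℝ ∞ f)
    (hg : ContDiff ℝ ∞ g) : ContDiff ℝ ∞ (fun t => F.1 (f t, g t)) :=
  F.2.comp (hf.prodMk hg)

theorem contDiff_deriv_smooth {f : ℝ → ℝ} (hf : ContDiff ℝ ∞ f) : ContDiff ℝ ∞ (deriv f) :=
  (contDiff_infty_iff_deriv.1 hf).2

theorem deriv_comp_pair (F : SmoothPlane) {f g : ℝ → ℝ} (hf : ContDiff ℝ ∞ f)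
    (hg : ContDiff ℝ ∞ g) :
    deriv (fun t => F.1 (f t, g t)) =
      fun t => F.dx.1 (f t, g t) * deriv f t + F.dy.1 (f t, g t) * deriv g t := by
  funext t
  have h1 : HasDerivAt f (deriv f t) t := (hf.differentiable (by simp) t).hasDerivAt
  have h2 : HasDerivAt g (deriv g t) t := (hg.differentiable (by simp) t).hasDerivAt
  have h3 : HasFDerivAt F.1 (fderiv ℝ F.1 (f t, g t)) (f t, g t) :=
    (F.2.differentiable (by simp) (f t, g t)).hasFDerivAt
  have h4 := (h3.comp_hasDerivAt t (h1.prodMk h2)).deriv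
  have e : ((deriv f t, deriv g t) : ℝ × ℝ) = deriv f t • (1, 0) + deriv g t • (0, 1) := by
    simp
  rw [e, map_add, map_smul, map_smul] at h4
  simp only [smul_eq_mul] at h4
  simp only [SmoothPlane.dx, SmoothPlane.dy]
  rw [mul_comm _ (deriv f t), mul_comm _ (deriv g t)]
  exact h4

theorem moderateOn_comp (hu : IsModerate u) (hw : IsModerate w) (bu : LocallyBoundedNet u)
    (bw : LocallyBoundedNet w) {K : Set ℝ} (hK : IsCompact K) (n : ℕ) :
    ∀ F : SmoothPlane,
      ModerateOn K (fun ε t => iteratedDeriv n (fun s => F.1 (u ε s, w ε s)) t) := by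
  induction n using Nat.strong_induction_on with
  | _ n ih =>
    intro F
    cases n with
    | zero =>
      obtain ⟨C, hC⟩ := bu K hK
      obtain ⟨C', hC'⟩ := bw K hK
      obtain ⟨B, hB⟩ := ((isCompact_Icc (a := -C) (b := C)).prod
        (isCompact_Icc (a := -C') (b := C'))).exists_bound_of_continuousOn
          F.2.continuous.continuousOn
      refine moderateOn_of_bounded B ?_
      filter_upwards [hC, hC'] with ε h1 h2 t ht
      simpa using hB (u ε t, w ε t) ⟨abs_le.1 (h1 t ht), abs_le.1 (h2 t ht)⟩
    | succ n =>
      have e : (fun (ε : Param) (t : ℝ) =>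
          iteratedDeriv (n + 1) (fun s => F.1 (u ε s, w ε s)) t) = fun ε t =>
          iteratedDeriv n (fun s => F.dx.1 (u ε s, w ε s) * deriv (u ε) s) t +
          iteratedDeriv n (fun s => F.dy.1 (u ε s, w ε s) * deriv (w ε) s) t := by
        funext ε t
        rw [iteratedDeriv_succ', deriv_comp_pair F (hu.1 ε) (hw.1 ε)]
        exact iteratedDeriv_fun_add_smooth
          ((contDiff_comp_pair F.dx (hu.1 ε) (hw.1 ε)).mul (contDiff_deriv_smooth (hu.1 ε)))
          ((contDiff_comp_pair F.dy (hu.1 ε) (hw.1 ε)).mul (contDiff_deriv_smooth (hw.1 ε))) n t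
      rw [e]
      refine ModerateOn.add ?_ ?_
      · refine moderateOn_iteratedDeriv_mul (u := fun ε s => F.dx.1 (u ε s, w ε s))
          (w := fun ε => deriv (u ε)) (fun ε => contDiff_comp_pair F.dx (hu.1 ε) (hw.1 ε))
          (fun ε => contDiff_deriv_smooth (hu.1 ε)) n (fun i hi => ih i (by omega) F.dx) ?_
        intro i _
        have := hu.2 K hK (i + 1)
        simp only [iteratedDeriv_succ'] at this
        exact this
      · refine moderateOn_iteratedDeriv_mul (u := fun ε s => F.dy.1 (u ε s, w ε s))
          (w := fun ε => deriv (w ε)) (fun ε => contDiff_comp_pair F.dy (hu.1 ε) (hw.1 ε))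
          (fun ε => contDiff_deriv_smooth (hw.1 ε)) n (fun i hi => ih i (by omega) F.dy) ?_
        intro i _
        have := hw.2 K hK (i + 1)
        simp only [iteratedDeriv_succ'] at this
        exact this

theorem negligibleOn_comp_sub (hu : IsModerate u) (hw : IsModerate w) (hu' : IsModerate u')
    (hw' : IsModerate w') (bu : LocallyBoundedNet u) (bw : LocallyBoundedNet w)
    (bu' : LocallyBoundedNet u') (bw' : LocallyBoundedNet w')
    (nu : IsNegligible (fun ε t => u ε t - u' ε t))
    (nw : IsNegligible (fun ε t => w ε t - w' ε t)) {K : Set ℝ} (hK : IsCompact K) (n : ℕ) :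
    ∀ F : SmoothPlane, NegligibleOn K (fun ε t =>
      iteratedDeriv n (fun s => F.1 (u ε s, w ε s) - F.1 (u' ε s, w' ε s)) t) := by
  have key : ∀ {f f' : Param → ℝ → ℝ}, IsModerate f → IsModerate f' →
      IsNegligible (fun ε t => f ε t - f' ε t) →
      ∀ i, NegligibleOn K (fun ε t => iteratedDeriv i (fun s => deriv (f ε) s - deriv (f' ε) s) t) := by
    intro f f' hf hf' hn i
    have h := hn K hK (i + 1)
    simp only [iteratedDeriv_succ'] at h
    have e : ∀ ε : Param, deriv (fun t => f ε t - f' ε t) =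
        fun t => deriv (f ε) t - deriv (f' ε) t := fun ε => deriv_fun_sub_net ⟨f, hf⟩ ⟨f', hf'⟩ ε
    simp only [e] at h
    exact h
  have keym : ∀ {f : Param → ℝ → ℝ}, IsModerate f →
      ∀ i, ModerateOn K (fun ε t => iteratedDeriv i (deriv (f ε)) t) := by
    intro f hf i
    have h := hf.2 K hK (i + 1)
    simp only [iteratedDeriv_succ'] at h
    exact h
  have cd : ∀ (F : SmoothPlane) (ε : Param),
      ContDiff ℝ ∞ (fun s => F.1 (u ε s, w ε s) - F.1 (u' ε s, w' ε s)) := fun F ε =>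
    (contDiff_comp_pair F (hu.1 ε) (hw.1 ε)).sub (contDiff_comp_pair F (hu'.1 ε) (hw'.1 ε))
  induction n using Nat.strong_induction_on with
  | _ n ih =>
    intro F
    cases n with
    | zero =>
      obtain ⟨C1, h1⟩ := bu K hK
      obtain ⟨C2, h2⟩ := bu' K hK
      obtain ⟨C3, h3⟩ := bw K hK
      obtain ⟨C4, h4⟩ := bw' K hK
      set A := max C1 C2
      set B := max C3 C4
      have hcv : Convex ℝ (Set.Icc (-A) A ×ˢ Set.Icc (-B) B) :=
        (convex_Icc _ _).prod (convex_Icc _ _)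
      obtain ⟨L, hL⟩ := ((isCompact_Icc (a := -A) (b := A)).prod
        (isCompact_Icc (a := -B) (b := B))).exists_bound_of_continuousOn
          (F.2.continuous_fderiv (by simp)).continuousOn
      intro M
      obtain ⟨D1, hD1, e1⟩ := NegligibleOn.exists_nonneg (nu K hK 0) M
      obtain ⟨D2, hD2, e2⟩ := NegligibleOn.exists_nonneg (nw K hK 0) M
      refine ⟨|L| * (D1 + D2), ?_⟩
      filter_upwards [h1, h2, h3, h4, e1, e2] with ε g1 g2 g3 g4 g5 g6 t ht
      have m1 : (u ε t, w ε t) ∈ Set.Icc (-A) A ×ˢ Set.Icc (-B) B :=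
        ⟨abs_le.1 ((g1 t ht).trans (le_max_left _ _)),
          abs_le.1 ((g3 t ht).trans (le_max_left _ _))⟩
      have m2 : (u' ε t, w' ε t) ∈ Set.Icc (-A) A ×ˢ Set.Icc (-B) B :=
        ⟨abs_le.1 ((g2 t ht).trans (le_max_right _ _)),
          abs_le.1 ((g4 t ht).trans (le_max_right _ _))⟩
      have hmv := hcv.norm_image_sub_le_of_norm_fderiv_le (𝕜 := ℝ) (C := |L|)
        (fun p _ => F.2.differentiable (by simp) p)
        (fun p hp => (hL p hp).trans (le_abs_self L)) m2 m1
      have a5 := g5 t ht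
      have a6 := g6 t ht
      simp only [iteratedDeriv_zero] at a5 a6 ⊢
      have hε : (0 : ℝ) < ε := ε.2.1
      have hn : ‖(u ε t, w ε t) - (u' ε t, w' ε t)‖ ≤ (D1 + D2) * (ε : ℝ) ^ M := by
        rw [Prod.mk_sub_mk, Prod.norm_mk, Real.norm_eq_abs, Real.norm_eq_abs, add_mul]
        have : 0 ≤ D1 * (ε : ℝ) ^ M := by positivity
        have : 0 ≤ D2 * (ε : ℝ) ^ M := by positivity
        exact max_le (by linarith) (by linarith)
      rw [Real.norm_eq_abs] at hmv
      calc _ ≤ _ := hmv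
        _ ≤ |L| * ((D1 + D2) * (ε : ℝ) ^ M) := by gcongr
        _ = _ := by ring
    | succ n =>
      have e : (fun (ε : Param) (t : ℝ) => iteratedDeriv (n + 1)
          (fun s => F.1 (u ε s, w ε s) - F.1 (u' ε s, w' ε s)) t) = fun ε t =>
          (iteratedDeriv n (fun s =>
            (F.dx.1 (u ε s, w ε s) - F.dx.1 (u' ε s, w' ε s)) * deriv (u ε) s) t +
          iteratedDeriv n (fun s =>
            (deriv (u ε) s - deriv (u' ε) s) * F.dx.1 (u' ε s, w' ε s)) t) +
          (iteratedDeriv n (fun s =>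
            (F.dy.1 (u ε s, w ε s) - F.dy.1 (u' ε s, w' ε s)) * deriv (w ε) s) t +
          iteratedDeriv n (fun s =>
            (deriv (w ε) s - deriv (w' ε) s) * F.dy.1 (u' ε s, w' ε s)) t) := by
        funext ε t
        have du := contDiff_deriv_smooth (hu.1 ε)
        have dw := contDiff_deriv_smooth (hw.1 ε)
        have du' := contDiff_deriv_smooth (hu'.1 ε)
        have dw' := contDiff_deriv_smooth (hw'.1 ε)
        have c1 := (cd F.dx ε).mul du
        have c2 := (du.sub du').mul (contDiff_comp_pair F.dx (hu'.1 ε) (hw'.1 ε))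
        have c3 := (cd F.dy ε).mul dw
        have c4 := (dw.sub dw').mul (contDiff_comp_pair F.dy (hu'.1 ε) (hw'.1 ε))
        rw [← iteratedDeriv_fun_add_smooth c1 c2, ← iteratedDeriv_fun_add_smooth c3 c4,
          ← iteratedDeriv_fun_add_smooth (c1.add c2) (c3.add c4), iteratedDeriv_succ']
        congr 1
        funext s
        have s1 := (contDiff_comp_pair F (hu.1 ε) (hw.1 ε)).differentiable (by simp) s
        have s2 := (contDiff_comp_pair F (hu'.1 ε) (hw'.1 ε)).differentiable (by simp) s
        rw [deriv_fun_sub s1 s2, deriv_comp_pair F (hu.1 ε) (hw.1 ε),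
          deriv_comp_pair F (hu'.1 ε) (hw'.1 ε)]
        ring
      rw [e]
      refine ((?_ : NegligibleOn K _).add ?_).add ((?_ : NegligibleOn K _).add ?_)
      · exact negligibleOn_iteratedDeriv_mul (w := fun ε => deriv (u ε)) (cd F.dx)
          (fun ε => contDiff_deriv_smooth (hu.1 ε)) n (fun i hi => ih i (by omega) F.dx)
          (fun i _ => keym hu i)
      · exact negligibleOn_iteratedDeriv_mul (w := fun ε s => F.dx.1 (u' ε s, w' ε s))
          (fun ε => (contDiff_deriv_smooth (hu.1 ε)).sub (contDiff_deriv_smooth (hu'.1 ε)))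
          (fun ε => contDiff_comp_pair F.dx (hu'.1 ε) (hw'.1 ε)) n (fun i _ => key hu hu' nu i)
          (fun i _ => moderateOn_comp hu' hw' bu' bw' hK i F.dx)
      · exact negligibleOn_iteratedDeriv_mul (w := fun ε => deriv (w ε)) (cd F.dy)
          (fun ε => contDiff_deriv_smooth (hw.1 ε)) n (fun i hi => ih i (by omega) F.dy)
          (fun i _ => keym hw i)
      · exact negligibleOn_iteratedDeriv_mul (w := fun ε s => F.dy.1 (u' ε s, w' ε s))
          (fun ε => (contDiff_deriv_smooth (hw.1 ε)).sub (contDiff_deriv_smooth (hw'.1 ε)))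
          (fun ε => contDiff_comp_pair F.dy (hu'.1 ε) (hw'.1 ε)) n (fun i _ => key hw hw' nw i)
          (fun i _ => moderateOn_comp hu' hw' bu' bw' hK i F.dy)

end Composition

/-- The net `F(u_ε, w_ε)`. -/
def compNet (F : SmoothPlane) (u w : moderateNets) (bu : LocallyBoundedNet u.1)
    (bw : LocallyBoundedNet w.1) : moderateNets :=
  ⟨fun ε t => F.1 (u.1 ε t, w.1 ε t),
    fun ε => contDiff_comp_pair F (u.2.1 ε) (w.2.1 ε),
    fun _ hK n => moderateOn_comp u.2 w.2 bu bw hK n F⟩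

/-- A locally bounded representative. -/
noncomputable def LBGenFun.rep (x : LBGenFun) : moderateNets := Classical.choose x.2

theorem LBGenFun.mk_rep (x : LBGenFun) : GenFun.mk x.rep = x.1 := (Classical.choose_spec x.2).1

theorem LBGenFun.bounded_rep (x : LBGenFun) : LocallyBoundedNet x.rep.1 :=
  (Classical.choose_spec x.2).2

/-- The generalized function `F(x, y)`, the class of `F(x_ε, y_ε)`; by
`SmoothPlane.comp_eq_mk` it does not depend on the representatives. -/
noncomputable def SmoothPlane.comp (F : SmoothPlane) (x y : LBGenFun) : GenFun :=
  GenFun.mk (compNet F x.rep y.rep x.bounded_rep y.bounded_rep)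

theorem SmoothPlane.comp_eq_mk (F : SmoothPlane) (x y : LBGenFun) (u w : moderateNets)
    (bu : LocallyBoundedNet u.1) (bw : LocallyBoundedNet w.1)
    (hu : GenFun.mk u = x.1) (hw : GenFun.mk w = y.1) :
    F.comp x y = GenFun.mk (compNet F u w bu bw) := by
  refine (GenFun.mk_eq_iff _ _).2 fun K hK n => ?_
  exact negligibleOn_comp_sub x.rep.2 y.rep.2 u.2 w.2 x.bounded_rep y.bounded_rep bu bw
    ((GenFun.mk_eq_iff _ _).1 (x.mk_rep.trans hu.symm))
    ((GenFun.mk_eq_iff _ _).1 (y.mk_rep.trans hw.symm)) hK n F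

/-- The generalized function `f(x)`, the class of `f(x_ε)`. -/
noncomputable def SmoothLine.comp (f : SmoothLine) (x : LBGenFun) : GenFun :=
  SmoothPlane.comp ⟨fun p => f.1 p.1, f.2.comp contDiff_fst⟩ x x

theorem SmoothLine.comp_eq_mk (f : SmoothLine) (x : LBGenFun) (u c : moderateNets)
    (bu : LocallyBoundedNet u.1) (hu : GenFun.mk u = x.1)
    (hc : ∀ ε t, c.1 ε t = f.1 (u.1 ε t)) : f.comp x = GenFun.mk c := by
  rw [SmoothLine.comp, SmoothPlane.comp_eq_mk _ x x u u bu bu hu hu]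
  congr 1
  apply Subtype.ext
  funext ε t
  exact (hc ε t).symm

/-! ### Distributions and association -/

/-- The distributions on the real line. -/
abbrev Distr : Type := 𝓓'((⊤ : TopologicalSpace.Opens ℝ), ℝ)

theorem integralAgainst_eq {g : ℝ → ℝ} (hg : LocallyIntegrable g)
    (φ : 𝓓((⊤ : TopologicalSpace.Opens ℝ), ℝ)) :
    TestFunction.integralAgainstBilinCLM (ContinuousLinearMap.mul ℝ ℝ) volume g φ =
      ∫ t, g t * φ t := by
  simp [hg.locallyIntegrableOn, mul_comm]

/-- The regular distribution `φ ↦ ∫ g φ` given by a locally integrable function `g`. -/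
noncomputable def regularDistr (g : ℝ → ℝ) (hg : LocallyIntegrable g) : Distr where
  toFun φ := ∫ t, g t * φ t
  map_add' φ ψ := by
    simp only [← integralAgainst_eq hg]
    exact map_add _ φ ψ
  map_smul' c φ := by
    simp only [← integralAgainst_eq hg]
    exact map_smul _ c φ
  cont := by
    refine (TestFunction.integralAgainstBilinCLM (Ω := (⊤ : TopologicalSpace.Opens ℝ))
      (n := ⊤) (ContinuousLinearMap.mul ℝ ℝ) volume g).continuous.congr fun φ => ?_
    exact integralAgainst_eq hg φ

theorem regularDistr_apply (g : ℝ → ℝ) (hg : LocallyIntegrable g)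
    (φ : 𝓓((⊤ : TopologicalSpace.Opens ℝ), ℝ)) :
    regularDistr g hg φ = ∫ t, g t * φ t := rfl

/-- The Heaviside step function `θ`. -/
noncomputable def step : ℝ → ℝ := Set.indicator (Set.Ici 0) 1

theorem locallyIntegrable_step : LocallyIntegrable step :=
  (locallyIntegrable_const (1 : ℝ)).indicator measurableSet_Ici

theorem locallyIntegrable_kink : LocallyIntegrable (fun t : ℝ => step t * t) := by
  have h : (fun t : ℝ => step t * t) = Set.indicator (Set.Ici 0) (fun t => t) := by
    funext t
    by_cases ht : t ∈ Set.Ici (0 : ℝ) <;> simp [step, ht]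
  rw [h]
  exact continuous_id.locallyIntegrable.indicator measurableSet_Ici

/-- The step function as a distribution. -/
noncomputable def thetaDistr : Distr := regularDistr step locallyIntegrable_step

/-- The kink function `u_+ = θ(u) u` as a distribution. -/
noncomputable def kinkDistr : Distr := regularDistr (fun t => step t * t) locallyIntegrable_kink

/-- The constant function `1` as a distribution. -/
noncomputable def oneDistr : Distr := regularDistr (fun _ => 1) (locallyIntegrable_const 1)

/-- The function `u` as a distribution. -/
noncomputable def idDistr : Distr := regularDistr (fun t => t) continuous_id.locallyIntegrable

/-- The Dirac measure at `0` as a distribution. -/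
noncomputable def diracDistr : Distr := Distribution.delta 0

/-- `g ≈ T`: the generalized function `g` is associated to the distribution `T`, that is, its
representatives `u_ε` satisfy `u_ε → T` in the space of distributions as `ε → 0`. -/
def Assoc (g : GenFun) (T : Distr) : Prop :=
  ∀ u : moderateNets, GenFun.mk u = g →
    ∀ φ : 𝓓((⊤ : TopologicalSpace.Opens ℝ), ℝ),
      Tendsto (fun ε : Param => ∫ t, u.1 ε t * φ t) toZero (𝓝 (T φ))

/-- A generalized delta function: an element of `G(ℝ)` with a representative `ρ_ε` that is
supported in `[-ε, ε]`, has integral tending to `1` and bounded `L¹`-norm for small `ε`. -/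
def IsGeneralizedDelta (ρ : GenFun) : Prop :=
  ∃ r : moderateNets, GenFun.mk r = ρ ∧
    (∀ ε : Param, tsupport (r.1 ε) ⊆ Set.Icc (-(ε : ℝ)) ε) ∧
    Tendsto (fun ε : Param => ∫ t, r.1 ε t) toZero (𝓝 1) ∧
    ∃ C : ℝ, ∀ᶠ ε in toZero, ∫ t, |r.1 ε t| ≤ C

/-! ### Impulsive pp-waves -/

/-- Axisymmetry: `F(x, y)` depends on `x² + y²` only. -/
def SmoothPlane.IsAxisymmetric (F : SmoothPlane) : Prop :=
  ∀ p q : ℝ × ℝ, p.1 ^ 2 + p.2 ^ 2 = q.1 ^ 2 + q.2 ^ 2 → F.1 p = F.1 q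

/-- The restriction `f(x) = F(x, 0)` of the profile function to the axis `y = 0`; for
axisymmetric `F` it is the profile as a function of the radius. -/
def SmoothPlane.profile (F : SmoothPlane) : SmoothLine :=
  ⟨fun x => F.1 (x, 0), F.2.comp (contDiff_id.prodMk contDiff_const)⟩

open GenFun in
/-- The geodesic equation in `G(ℝ)` of the regularized metric
`F(x,y) ρ(u) du² - du dv + dx² + dy²`, with affine parameter `u`, for locally bounded
`(v, x, y)`. -/
structure IsGeodesic (F : SmoothPlane) (ρ : GenFun) (v x y : LBGenFun) : Prop where
  eq_v : D (D v.1) = F.comp x y * D ρ +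
    2 * (F.dx.comp x y * D x.1 + F.dy.comp x y * D y.1) * ρ
  eq_x : D (D x.1) = (1 / 2 : ℝ) • (F.dx.comp x y * ρ)
  eq_y : D (D y.1) = (1 / 2 : ℝ) • (F.dy.comp x y * ρ)

open GenFun in
/-- The Jacobi equation in `G(ℝ)` for a deviation field with components
`(N 0, N 1, N 2, N 3) = (N^u, N^v, N^x, N^y)` along a geodesic in the hypersurface `y = 0`
with transverse coordinate `x`, for an axisymmetric wave with radial profile `f`. -/
structure IsJacobiField (f : SmoothLine) (ρ : GenFun) (x : LBGenFun) (N : Fin 4 → GenFun) :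
    Prop where
  eq_u : D (D (N 0)) = 0
  eq_y : D (D (N 3)) = 0
  eq_x : D (D (N 2)) =
    (D (N 0) * f.d.comp x + (1 / 2 : ℝ) • (N 2 * f.d.d.comp x)) * ρ +
      (1 / 2 : ℝ) • (f.d.comp x * N 0 * D ρ)
  eq_v : D (D (N 1)) =
    2 * D (N 2 * f.d.comp x * ρ) - N 2 * f.d.comp x * D ρ + D (D (N 0 * f.comp x * ρ)) -
      N 0 * f.d.d.comp x * D x.1 ^ 2 * ρ - N 0 * f.d.comp x * D (D x.1) * ρ

/-- The field `N` and its derivative have the values `n` and `n'` at `u = -1`. -/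
def HasInitialData (N : Fin 4 → GenFun) (n n' : Fin 4 → GenNum) : Prop :=
  ∀ i, (N i).at (-1) = n i ∧ (GenFun.D (N i)).at (-1) = n' i

/-- A real vector as a vector of (constant) generalized numbers. -/
noncomputable def constVec (c : Fin 4 → ℝ) : Fin 4 → GenNum := fun i => algebraMap ℝ GenNum (c i)

end Colombeau

open Colombeau

namespace Colombeau

/-! ### Scalar estimates for second order equations -/

/-! The Jacobi system becomes triangular after two substitutions. Since F is even in y, the geodesic
stays in y = 0 (`IsGeodesic.y_eq_zero`), so ẍ = ½ f'(x) ρ. Differentiating this shows that ẋ N^u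
absorbs every N^u term in the equation for N^x: P = N^x - ẋ N^u satisfies P̈ = ½ f''(x) ρ P.
Likewise W = N^v - (2Pẋ + ẋ² N^u + N^u f(x) ρ) satisfies Ẅ = 0. The system is therefore equivalent
to three free equations and one linear impulsive equation (`isJacobiField_iff`). The initial data do
not change, because ẋ, ẍ, ρ and ρ̇ vanish at u = -1 (`hasInitialData_iff`).

For P̈ = c ρ P with c locally bounded, everything rests on one estimate, uniform in ε: ρ_ε has
bounded L¹ norm and lives on an interval of length 2ε, so for small ε it cannot make P grow
(`exists_bound_of_impulsive_inequality`). The estimate gives uniqueness, moderateness of the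
solutions built by contraction for each small ε, and local boundedness when the data are real.

In (ii) P = 0, so N^x = a(1+u) ẋ and N^v = b(1+u) + a(1+u)(ẋ² + f(x) ρ). In (iii) N^u = 0, so N^x =
P and N^v = 2Pẋ. Both x and P satisfy ẅ = h ρ with h locally bounded (`IsKicked`): such a w is
nearly constant up to the impulse, moves only O(ε) across it, and leaves with velocity lim h. Hence
ẋ and P converge pointwise off 0 and stay locally bounded. Dominated convergence then gives the
regular terms, θ² = θ simplifies the products, and f(x) ρ tends to f(x₀) δ. -/

theorem differentiable_deriv_of_smooth {w : ℝ → ℝ} (hw : ContDiff ℝ ∞ w) :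
    Differentiable ℝ (deriv w) :=
  (contDiff_deriv_smooth hw).differentiable (by simp)

/-- The mean value inequality, applied to the derivative and then to the function. The base point is
free so that it can be the interior point -1 before the impulse and the endpoint ε after it. -/
theorem sub_le_of_abs_deriv_deriv_le {w : ℝ → ℝ} (hw : ContDiff ℝ ∞ w) {a b c η : ℝ}
    (hc : c ∈ Set.Icc a b) (h : ∀ t ∈ Set.Icc a b, |deriv (deriv w) t| ≤ η) :
    ∀ t ∈ Set.Icc a b, |deriv w t - deriv w c| ≤ η * (b - a) ∧
      |w t - w c| ≤ (|deriv w c| + η * (b - a)) * (b - a) := by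
  have hη : 0 ≤ η := (abs_nonneg _).trans (h c hc)
  have hl : ∀ t ∈ Set.Icc a b, |t - c| ≤ b - a := fun t ht => by
    rw [abs_le]; constructor <;> linarith [ht.1, ht.2, hc.1, hc.2]
  have h1 : ∀ t ∈ Set.Icc a b, |deriv w t - deriv w c| ≤ η * (b - a) := fun t ht => by
    have := (convex_Icc a b).norm_image_sub_le_of_norm_deriv_le (f := deriv w) (C := η)
      (fun s _ => differentiable_deriv_of_smooth hw s) h hc ht
    exact this.trans (mul_le_mul_of_nonneg_left (hl t ht) hη)
  refine fun t ht => ⟨h1 t ht, ?_⟩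
  have h2 : ∀ s ∈ Set.Icc a b, |deriv w s| ≤ |deriv w c| + η * (b - a) := fun s hs => by
    have := h1 s hs
    have h3 := abs_sub_abs_le_abs_sub (deriv w s) (deriv w c)
    linarith
  have := (convex_Icc a b).norm_image_sub_le_of_norm_deriv_le (f := w)
    (fun s _ => hw.differentiable (by simp) s) h2 hc ht
  exact this.trans (mul_le_mul_of_nonneg_left (hl t ht) ((abs_nonneg _).trans (h2 c hc)))

/-- Inside the impulse the second derivative is large pointwise and only its integral is controlled,
so the fundamental theorem of calculus replaces the first mean value step. -/
theorem sub_le_of_abs_deriv_deriv_le_integral {w φ : ℝ → ℝ} (hw : ContDiff ℝ ∞ w) {a b J : ℝ}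
    (hφ : Continuous φ) (h : ∀ t ∈ Set.Icc a b, |deriv (deriv w) t| ≤ φ t)
    (hJ : ∫ t in a..b, φ t ≤ J) :
    ∀ t ∈ Set.Icc a b, |deriv w t - deriv w a| ≤ J ∧
      |w t - w a| ≤ (|deriv w a| + J) * (b - a) := by
  have h1 : ∀ t ∈ Set.Icc a b, |deriv w t - deriv w a| ≤ J := fun t ht => by
    have e : ∫ s in a..t, deriv (deriv w) s = deriv w t - deriv w a :=
      intervalIntegral.integral_deriv_eq_sub
        (fun s _ => differentiable_deriv_of_smooth hw s)
        ((contDiff_deriv_smooth (contDiff_deriv_smooth hw)).continuous.intervalIntegrable _ _)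
    have hm : ∀ s ∈ Set.Icc a b, 0 ≤ φ s := fun s hs => (abs_nonneg _).trans (h s hs)
    rw [← e]
    calc |∫ s in a..t, deriv (deriv w) s| ≤ ∫ s in a..t, φ s := by
          rw [← Real.norm_eq_abs]
          exact intervalIntegral.norm_integral_le_of_norm_le ht.1
            (Eventually.of_forall fun s hs => h s ⟨hs.1.le, hs.2.trans ht.2⟩)
            (hφ.intervalIntegrable _ _)
      _ ≤ ∫ s in a..b, φ s := by
          rw [← intervalIntegral.integral_add_adjacent_intervals (hφ.intervalIntegrable a t)
            (hφ.intervalIntegrable t b)]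
          have := intervalIntegral.integral_nonneg (μ := volume) (f := φ) ht.2
            fun s hs => hm s ⟨ht.1.trans hs.1, hs.2⟩
          linarith
      _ ≤ J := hJ
  refine fun t ht => ⟨h1 t ht, ?_⟩
  have ha : a ∈ Set.Icc a b := ⟨le_rfl, ht.1.trans ht.2⟩
  have h2 : ∀ s ∈ Set.Icc a b, |deriv w s| ≤ |deriv w a| + J := fun s hs => by
    have := h1 s hs
    have h3 := abs_sub_abs_le_abs_sub (deriv w s) (deriv w a)
    linarith
  have := (convex_Icc a b).norm_image_sub_le_of_norm_deriv_le (f := w)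
    (fun s _ => hw.differentiable (by simp) s) h2 ha ht
  refine this.trans (mul_le_mul_of_nonneg_left ?_ ((abs_nonneg _).trans (h2 a ha)))
  rw [Real.norm_eq_abs, abs_of_nonneg (by linarith [ht.1])]
  linarith [ht.2]

/-- A second order inequality with an impulsive coefficient of small support is controlled by
its initial data and inhomogeneity. -/
theorem exists_bound_of_impulsive_inequality (T C : ℝ) (hT : 1 ≤ T) (hC : 0 ≤ C) :
    ∃ B : ℝ, 0 ≤ B ∧ ∀ (ε : ℝ) (w k : ℝ → ℝ) (m : ℝ), 0 < ε → ε < 1 → 4 * ε * C ≤ 1 →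
      ContDiff ℝ ∞ w → Continuous k → (∀ t, 0 ≤ k t) →
      (∀ t, t ∉ Set.Icc (-ε) ε → k t = 0) → (∫ t in (-ε)..ε, k t) ≤ C →
      |w (-1)| ≤ m → |deriv w (-1)| ≤ m →
      (∀ t ∈ Set.Icc (-T) T, |deriv (deriv w) t| ≤ k t * |w t| + m) →
      ∀ t ∈ Set.Icc (-T) T, |w t| ≤ B * m ∧ |deriv w t| ≤ B * m := by
  -- `L` bounds w and w' before the impulse; `L2` and `L3` bound w and w' during it, each relative
  -- to m.
  set L : ℝ := (1 + T) ^ 2 with hL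
  set L2 : ℝ := 2 * (3 * L + 4) with hL2
  set L3 : ℝ := L + C * L2 + 2 with hL3
  have hL0 : 0 ≤ L := by positivity
  have hL20 : 0 ≤ L2 := by positivity
  have hL30 : 0 ≤ L3 := by positivity
  refine ⟨L + L2 + L3 + (L3 + T) * T + T, by positivity, ?_⟩
  intro ε w k m hε hε1 hεC hw hk hk0 hks hki h0 h0' hode
  have hm : 0 ≤ m := (abs_nonneg _).trans h0
  -- By continuity k also vanishes at ±ε, so the impulse-free bound holds on the closed intervals to
  -- either side.
  have key : ∀ t ∈ Set.Icc (-T) T, t ∉ Set.Ioo (-ε) ε → |deriv (deriv w) t| ≤ m := by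
    have hkz : ∀ t, t ∉ Set.Ioo (-ε) ε → k t = 0 := by
      intro t ht
      have hcl : IsClosed {s | k s = 0} := isClosed_eq hk continuous_const
      have hsub : closure (Set.Icc (-ε) ε)ᶜ ⊆ {s | k s = 0} :=
        hcl.closure_subset_iff.2 fun s hs => hks s hs
      apply hsub
      rw [closure_compl, interior_Icc]
      exact ht
    intro t ht hn
    simpa [hkz t hn] using hode t ht
  -- the left part
  have left : ∀ t ∈ Set.Icc (-T) (-ε), |w t| ≤ L * m ∧ |deriv w t| ≤ L * m := by
    intro t ht
    obtain ⟨g1, g2⟩ := sub_le_of_abs_deriv_deriv_le (c := -1) hw ⟨by linarith, by linarith⟩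
      (fun s hs => key s ⟨hs.1, by linarith [hs.2]⟩ fun h => by linarith [h.1, hs.2]) t ht
    have hlen : -ε - -T ≤ T := by linarith
    have hlen0 : 0 ≤ -ε - -T := by linarith [ht.1, ht.2]
    have e1 : m * (-ε - -T) ≤ m * T := mul_le_mul_of_nonneg_left hlen hm
    have e2 : (|deriv w (-1)| + m * (-ε - -T)) * (-ε - -T) ≤ (m + m * T) * T :=
      mul_le_mul (by linarith) hlen hlen0 (by positivity)
    have a1 := abs_sub_abs_le_abs_sub (w t) (w (-1))
    have a2 := abs_sub_abs_le_abs_sub (deriv w t) (deriv w (-1))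
    have hmT : 0 ≤ m * T := by positivity
    have hmT2 : 0 ≤ m * T ^ 2 := by positivity
    constructor <;> rw [hL] <;> nlinarith
  -- the middle part
  have middle : ∀ t ∈ Set.Icc (-ε) ε, |w t| ≤ L2 * m ∧ |deriv w t| ≤ L3 * m := by
    obtain ⟨l1, l2⟩ := left (-ε) ⟨by linarith, le_rfl⟩
    -- With S the maximum of |w| on the support, the impulse contributes at most 2εC·S ≤ S/2, which
    -- is absorbed on the left. This is where 4εC ≤ 1 enters.
    obtain ⟨s, hs, hmax⟩ := isCompact_Icc.exists_isMaxOn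
      (Set.nonempty_Icc.2 (by linarith : -ε ≤ ε)) (hw.continuous.abs.continuousOn)
    set S := |w s| with hS
    have hS0 : 0 ≤ S := abs_nonneg _
    have hle : ∀ t ∈ Set.Icc (-ε) ε, |w t| ≤ S := fun t ht => hmax ht
    have hφ : Continuous fun t => k t * S + m := by fun_prop
    have hJ : ∫ t in (-ε)..ε, (k t * S + m) ≤ C * S + 2 * ε * m := by
      have hkS : Continuous fun t => k t * S := hk.mul continuous_const
      rw [intervalIntegral.integral_add (hkS.intervalIntegrable _ _) (by simp)]
      · rw [intervalIntegral.integral_mul_const, intervalIntegral.integral_const, smul_eq_mul]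
        have := mul_le_mul_of_nonneg_right hki hS0
        linarith
    have H := sub_le_of_abs_deriv_deriv_le_integral hw hφ (fun t ht =>
      (hode t ⟨by linarith [ht.1], by linarith [ht.2]⟩).trans
        (by have := mul_le_mul_of_nonneg_left (hle t ht) (hk0 t); linarith)) hJ
    have hεm : ε * m ≤ m := by nlinarith
    have hεm0 : 0 ≤ ε * m := by positivity
    have hLm0 : 0 ≤ L * m := by positivity
    have hSle : S ≤ L2 * m := by
      have h2 := (H s hs).2
      have a1 := abs_sub_abs_le_abs_sub (w s) (w (-ε))
      have e1 : (|deriv w (-ε)| + (C * S + 2 * ε * m)) * (ε - -ε) ≤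
          2 * (L * m) + S / 2 + 4 * m := by
        have : (|deriv w (-ε)| + (C * S + 2 * ε * m)) * (ε - -ε) =
          2 * (ε * |deriv w (-ε)|) + (4 * ε * C) * S / 2 + 4 * (ε * (ε * m)) := by ring
        rw [this]
        have b1 : ε * |deriv w (-ε)| ≤ 1 * (L * m) :=
          mul_le_mul hε1.le l2 (abs_nonneg _) zero_le_one
        have b2 : (4 * ε * C) * S ≤ 1 * S := mul_le_mul_of_nonneg_right hεC hS0
        have b3 : ε * (ε * m) ≤ 1 * m := mul_le_mul hε1.le hεm hεm0 zero_le_one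
        linarith
      rw [hL2]
      linarith
    intro t ht
    refine ⟨(hle t ht).trans hSle, ?_⟩
    have a2 := abs_sub_abs_le_abs_sub (deriv w t) (deriv w (-ε))
    have h1 := (H t ht).1
    have := mul_le_mul_of_nonneg_left hSle hC
    rw [hL3]
    linarith
  -- the right part
  have right : ∀ t ∈ Set.Icc ε T, |w t| ≤ (L2 + (L3 + T) * T) * m ∧
      |deriv w t| ≤ (L3 + T) * m := by
    intro t ht
    have hT' : ε ≤ T := by linarith
    obtain ⟨l1, l2⟩ := middle ε ⟨by linarith, le_rfl⟩
    obtain ⟨g1, g2⟩ := sub_le_of_abs_deriv_deriv_le (c := ε) hw ⟨le_rfl, hT'⟩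
      (fun s hs => key s ⟨by linarith [hs.1], hs.2⟩ fun h => by linarith [h.2, hs.1]) t ht
    have hlen : T - ε ≤ T := by linarith
    have hlen0 : 0 ≤ T - ε := by linarith
    have e1 : m * (T - ε) ≤ m * T := mul_le_mul_of_nonneg_left hlen hm
    have e2 : (|deriv w ε| + m * (T - ε)) * (T - ε) ≤ (L3 * m + m * T) * T :=
      mul_le_mul (by linarith) hlen hlen0 (by positivity)
    have a1 := abs_sub_abs_le_abs_sub (w t) (w ε)
    have a2 := abs_sub_abs_le_abs_sub (deriv w t) (deriv w ε)
    constructor <;> linarith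
  have hT0 : 0 ≤ T := by linarith
  have p1 : 0 ≤ L * m := by positivity
  have p2 : 0 ≤ L2 * m := by positivity
  have p3 : 0 ≤ L3 * m := by positivity
  have p4 : 0 ≤ (L3 + T) * T * m := by positivity
  have p5 : 0 ≤ T * m := by positivity
  intro t ht
  rcases le_total t (-ε) with h1 | h1
  · obtain ⟨q1, q2⟩ := left t ⟨ht.1, h1⟩
    constructor <;> linarith
  · rcases le_total t ε with h2 | h2
    · obtain ⟨q1, q2⟩ := middle t ⟨h1, h2⟩
      constructor <;> linarith
    · obtain ⟨q1, q2⟩ := right t ⟨h2, ht.2⟩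
      constructor <;> linarith

/-- The twice integrated equation is a fixed point problem on C([-ε, ε]). The operator has Lipschitz
constant at most 2εC ≤ 1/2. Because g vanishes outside, the integral formula extends the fixed point
to a solution on the whole line. -/
theorem exists_solution_of_impulsive_equation {ε C : ℝ} (hε : 0 < ε) (hε1 : ε < 1)
    (hεC : 4 * ε * C ≤ 1) {g : ℝ → ℝ} (hg : ContDiff ℝ ∞ g)
    (hgs : ∀ t, t ∉ Set.Icc (-ε) ε → g t = 0) (hgi : ∫ t in (-ε)..ε, |g t| ≤ C) (p₀ p₁ : ℝ) :
    ∃ P : ℝ → ℝ, ContDiff ℝ ∞ P ∧ (∀ t, deriv (deriv P) t = g t * P t) ∧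
      P (-1) = p₀ ∧ deriv P (-1) = p₁ := by
  have hle : -ε ≤ ε := by linarith
  let ext : C(Set.Icc (-ε) ε, ℝ) → ℝ → ℝ := fun φ => Set.IccExtend hle φ
  have hext : ∀ φ, Continuous (ext φ) := fun φ => φ.continuous.Icc_extend'
  let q : C(Set.Icc (-ε) ε, ℝ) → ℝ → ℝ := fun φ s => ∫ r in (-ε)..s, g r * ext φ r
  have hgc : ∀ φ, Continuous fun r => g r * ext φ r := fun φ => hg.continuous.mul (hext φ)
  have hq : ∀ φ s, HasDerivAt (q φ) (g s * ext φ s) s := fun φ s =>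
    (hgc φ).integral_hasStrictDerivAt _ _ |>.hasDerivAt
  have hqc : ∀ φ, Continuous (q φ) := fun φ =>
    continuous_iff_continuousAt.2 fun s => (hq φ s).continuousAt
  let Q : C(Set.Icc (-ε) ε, ℝ) → ℝ → ℝ := fun φ t => p₀ + p₁ * (t + 1) + ∫ s in (-ε)..t, q φ s
  have hQ : ∀ φ t, HasDerivAt (Q φ) (p₁ + q φ t) t := fun φ t => by
    have h1 := ((hqc φ).integral_hasStrictDerivAt (-ε) t).hasDerivAt
    have h2 : HasDerivAt (fun t : ℝ => p₀ + p₁ * (t + 1)) p₁ t := by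
      simpa using (((hasDerivAt_id t).add_const (1 : ℝ)).const_mul p₁).const_add p₀
    exact h2.add h1
  have hQc : ∀ φ, Continuous (Q φ) := fun φ =>
    continuous_iff_continuousAt.2 fun s => (hQ φ s).continuousAt
  let Φ : C(Set.Icc (-ε) ε, ℝ) → C(Set.Icc (-ε) ε, ℝ) := fun φ =>
    ⟨fun t => Q φ t, (hQc φ).comp continuous_subtype_val⟩
  have hΦ : ContractingWith (1 / 2) Φ := by
    refine ⟨by norm_num, LipschitzWith.of_dist_le_mul fun φ ψ => ?_⟩
    have hd : 0 ≤ dist φ ψ := dist_nonneg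
    have hqd : ∀ s ∈ Set.Icc (-ε) ε, |q φ s - q ψ s| ≤ C * dist φ ψ := by
      intro s hs
      have e : q φ s - q ψ s = ∫ r in (-ε)..s, (g r * ext φ r - g r * ext ψ r) :=
        (intervalIntegral.integral_sub ((hgc φ).intervalIntegrable _ _)
          ((hgc ψ).intervalIntegrable _ _)).symm
      have hgd : Continuous fun r => |g r| * dist φ ψ := hg.continuous.abs.mul continuous_const
      rw [e, ← Real.norm_eq_abs]
      calc ‖∫ r in (-ε)..s, (g r * ext φ r - g r * ext ψ r)‖
          ≤ ∫ r in (-ε)..s, |g r| * dist φ ψ := by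
            refine intervalIntegral.norm_integral_le_of_norm_le hs.1
              (Eventually.of_forall fun r hr => ?_) (hgd.intervalIntegrable _ _)
            rw [← mul_sub, norm_mul, Real.norm_eq_abs]
            refine mul_le_mul_of_nonneg_left ?_ (abs_nonneg _)
            exact (ContinuousMap.dist_apply_le_dist (f := φ) (g := ψ) (Set.projIcc _ _ hle r))
        _ ≤ ∫ r in (-ε)..ε, |g r| * dist φ ψ := by
            rw [← intervalIntegral.integral_add_adjacent_intervals
              (hgd.intervalIntegrable (-ε) s) (hgd.intervalIntegrable s ε)]
            have := intervalIntegral.integral_nonneg (μ := volume)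
              (f := fun r => |g r| * dist φ ψ) hs.2 fun r _ => by positivity
            linarith
        _ ≤ C * dist φ ψ := by
            rw [intervalIntegral.integral_mul_const]
            exact mul_le_mul_of_nonneg_right hgi hd
    refine (ContinuousMap.dist_le (by positivity)).2 fun t => ?_
    have e : Q φ t - Q ψ t = ∫ s in (-ε)..(t : ℝ), (q φ s - q ψ s) := by
      rw [intervalIntegral.integral_sub ((hqc φ).intervalIntegrable _ _)
        ((hqc ψ).intervalIntegrable _ _)]
      simp only [Q]
      ring
    have hb := intervalIntegral.norm_integral_le_of_norm_le_const (a := -ε) (b := t)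
      (f := fun s => q φ s - q ψ s) (C := C * dist φ ψ) fun s hs => by
        rw [Set.uIoc_of_le t.2.1] at hs
        exact hqd s ⟨hs.1.le, hs.2.trans t.2.2⟩
    rw [← e, abs_of_nonneg (by linarith [t.2.1])] at hb
    have hC : 0 ≤ C * dist φ ψ := (abs_nonneg _).trans (hqd t t.2)
    have h2 : C * dist φ ψ * (t - -ε) ≤ C * dist φ ψ * (2 * ε) :=
      mul_le_mul_of_nonneg_left (by linarith [t.2.2]) hC
    have h3 := mul_le_mul_of_nonneg_right hεC hd
    have h4 : dist (Φ φ t) (Φ ψ t) = ‖Q φ t - Q ψ t‖ := rfl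
    rw [h4]
    push_cast
    linarith
  obtain ⟨φ, hφ⟩ : ∃ φ, Φ φ = φ := ⟨_, hΦ.fixedPoint_isFixedPt⟩
  -- The fixed point identity is available only on [-ε, ε]; elsewhere the factor g kills both sides.
  have hagree : ∀ t, g t * ext φ t = g t * Q φ t := by
    intro t
    by_cases ht : t ∈ Set.Icc (-ε) ε
    · have h1 : ext φ t = φ ⟨t, ht⟩ := Set.IccExtend_of_mem hle _ ht
      have h2 : Φ φ ⟨t, ht⟩ = φ ⟨t, ht⟩ := by rw [hφ]
      rw [h1, ← h2]
      rfl
    · simp [hgs t ht]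
  have d1 : deriv (Q φ) = fun t => p₁ + q φ t := funext fun t => (hQ φ t).deriv
  have d2 : ∀ t, deriv (deriv (Q φ)) t = g t * Q φ t := fun t => by
    rw [d1, ((hq φ t).const_add p₁).deriv, hagree]
  -- Bootstrap: if Q is Cⁿ then so is Q'' = gQ, which raises the regularity of Q.
  have hsm : ∀ n : ℕ, ContDiff ℝ n (Q φ) := by
    intro n
    induction n with
    | zero => exact contDiff_zero.2 (hQc φ)
    | succ n ih =>
      have h2 : ContDiff ℝ n (deriv (deriv (Q φ))) := by
        rw [funext d2]
        exact (hg.of_le (by exact_mod_cast le_top)).mul ih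
      have h1 : ContDiff ℝ (n + 1) (deriv (Q φ)) := by
        refine contDiff_succ_iff_deriv.2 ⟨fun t => ?_, by simp, h2⟩
        rw [d1]
        exact ((hq φ t).const_add p₁).differentiableAt
      have := (contDiff_succ_iff_deriv (n := n)).2
        ⟨fun t => (hQ φ t).differentiableAt, by simp, h1.of_le (by norm_cast; omega)⟩
      exact_mod_cast this
  -- The integrals start at -ε while the data are prescribed at -1; nothing accumulates in between.
  have hz : ∀ s ∈ Set.Icc (-1) (-ε), q φ s = 0 := by
    intro s hs
    have : ∀ r ∈ Set.uIcc (-ε) s, g r * ext φ r = 0 := by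
      have hcl : IsClosed {r | g r = 0} := isClosed_eq hg.continuous continuous_const
      have hsub : closure (Set.Icc (-ε) ε)ᶜ ⊆ {r | g r = 0} :=
        hcl.closure_subset_iff.2 fun r hr => hgs r hr
      intro r hr
      rw [Set.uIcc_of_ge hs.2] at hr
      have : g r = 0 := hsub (by
        rw [closure_compl, interior_Icc]
        exact fun h => by linarith [h.1, hr.2])
      rw [this, zero_mul]
    simp only [q]
    rw [intervalIntegral.integral_congr (g := fun _ => (0 : ℝ)) this]
    simp
  refine ⟨Q φ, contDiff_infty.2 hsm, d2, ?_, ?_⟩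
  · have : ∫ s in (-ε)..(-1), q φ s = 0 := by
      rw [intervalIntegral.integral_congr (g := fun _ => (0 : ℝ))]
      · simp
      · intro s hs
        rw [Set.uIcc_of_ge (by linarith)] at hs
        exact hz s hs
    simp only [Q, this]
    ring
  · rw [d1]
    simp only
    rw [hz (-1) ⟨le_rfl, by linarith⟩, add_zero]

/-! ### Negligibility is detected on the undifferentiated net -/

theorem eventually_toZero_lt {δ : ℝ} (hδ : 0 < δ) : ∀ᶠ ε : Param in toZero, (ε : ℝ) < δ :=
  (tendsto_comap (f := fun ε : Param => (ε : ℝ)) (x := 𝓝 0)).eventually (gt_mem_nhds hδ)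

theorem exists_subset_Icc {K : Set ℝ} (hK : IsCompact K) :
    ∃ T : ℝ, 1 ≤ T ∧ K ⊆ Set.Icc (-T) T := by
  obtain ⟨R, hR⟩ := hK.isBounded.subset_closedBall 0
  refine ⟨max 1 R, le_max_left _ _, fun t ht => ?_⟩
  have := hR ht
  rw [mem_closedBall_zero_iff, Real.norm_eq_abs] at this
  exact abs_le.1 (this.trans (le_max_right _ _))

/-- A difference quotient interpolates between a negligible function and a moderate second
derivative. -/
theorem negligibleOn_deriv {v : Param → ℝ → ℝ} (hv : ∀ ε, ContDiff ℝ ∞ (v ε))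
    (hm : ∀ K, IsCompact K → ModerateOn K fun ε t => deriv (deriv (v ε)) t)
    (hn : ∀ K, IsCompact K → NegligibleOn K v) {K : Set ℝ} (hK : IsCompact K) :
    NegligibleOn K fun ε t => deriv (v ε) t := by
  obtain ⟨T, hT, hKT⟩ := exists_subset_Icc hK
  intro M
  obtain ⟨N, C, hC, h1⟩ := (hm (Set.Icc (-T) (T + 1)) isCompact_Icc).exists_nonneg
  obtain ⟨C', hC', h2⟩ := (hn (Set.Icc (-T) (T + 1)) isCompact_Icc).exists_nonneg (2 * M + N)
  refine ⟨2 * C' + C, ?_⟩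
  filter_upwards [h1, h2] with ε g1 g2 t ht
  have ht' := hKT ht
  have h0 : (0 : ℝ) < ε := ε.2.1
  -- This step balances both errors: ε^(2M+N)/h for the quotient and ε^(-N)·h for the variation of
  -- v' are each ε^M. Since h ≤ 1, the interval up to T + 1 is long enough.
  set h : ℝ := (ε : ℝ) ^ (M + N) with hh
  have hpos : 0 < h := by positivity
  have hle : h ≤ 1 := pow_le_one₀ h0.le ε.2.2.le
  obtain ⟨ξ, hξ, hd⟩ := exists_deriv_eq_slope (v ε) (show t < t + h by linarith)
    (hv ε).continuous.continuousOn fun s _ => ((hv ε).differentiable (by simp) s).differentiableWithinAt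
  have a1 := g2 t ⟨ht'.1, by linarith [ht'.2]⟩
  have a2 := g2 (t + h) ⟨by linarith [ht'.1], by linarith [ht'.2]⟩
  have a3 := (convex_Icc t (t + h)).norm_image_sub_le_of_norm_deriv_le (f := deriv (v ε))
    (C := C * ((ε : ℝ) ^ N)⁻¹) (fun s _ => differentiable_deriv_of_smooth (hv ε) s)
    (fun s hs => g1 s ⟨by linarith [ht'.1, hs.1], by linarith [ht'.2, hs.2]⟩)
    (⟨hξ.1.le, hξ.2.le⟩ : ξ ∈ Set.Icc t (t + h)) (⟨le_rfl, by linarith⟩ : t ∈ Set.Icc t (t + h))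
  rw [Real.norm_eq_abs, Real.norm_eq_abs, abs_of_nonpos (by linarith [hξ.1] : t - ξ ≤ 0)] at a3
  have a4 : C * ((ε : ℝ) ^ N)⁻¹ * -(t - ξ) ≤ C * ((ε : ℝ) ^ N)⁻¹ * h :=
    mul_le_mul_of_nonneg_left (by linarith [hξ.2]) (by positivity)
  have a5 : C * ((ε : ℝ) ^ N)⁻¹ * h = C * (ε : ℝ) ^ M := by
    rw [hh, pow_add]; field_simp
  have a6 : |deriv (v ε) ξ| ≤ 2 * C' * (ε : ℝ) ^ M := by
    rw [hd, add_sub_cancel_left, abs_div, abs_of_pos hpos, div_le_iff₀ hpos]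
    have e : 2 * C' * (ε : ℝ) ^ M * h = 2 * (C' * (ε : ℝ) ^ (2 * M + N)) := by
      rw [hh]; ring
    rw [e]
    have := abs_sub (v ε (t + h)) (v ε t)
    linarith
  have a7 := abs_sub_abs_le_abs_sub (deriv (v ε) t) (deriv (v ε) ξ)
  linarith

theorem isModerate_iteratedDeriv {u : Param → ℝ → ℝ} (hu : IsModerate u) (n : ℕ) :
    IsModerate fun ε => iteratedDeriv n (u ε) := by
  refine ⟨fun ε => ?_, fun K hK m => ?_⟩
  · simpa [iteratedDeriv_eq_iterate] using (hu.1 ε).iterate_deriv n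
  · have := hu.2 K hK (m + n)
    simp only [iteratedDeriv_eq_iterate, Function.iterate_add_apply] at this ⊢
    exact this

/-- This lets equality in the algebra be checked without differentiating, so the a priori bounds on
the function alone suffice for uniqueness. -/
theorem isNegligible_of_negligibleOn {u : Param → ℝ → ℝ} (hu : IsModerate u)
    (h : ∀ K, IsCompact K → NegligibleOn K u) : IsNegligible u := by
  intro K hK n
  induction n generalizing K with
  | zero => simpa using h K hK
  | succ n ih =>
    simp only [iteratedDeriv_succ]
    refine negligibleOn_deriv (v := fun ε => iteratedDeriv n (u ε))
      (isModerate_iteratedDeriv hu n).1 (fun K hK => ?_) (fun K hK => ih K hK) hK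
    have := hu.2 K hK (n + 2)
    simp only [iteratedDeriv_succ] at this
    exact this

theorem isModerate_sub {u w : Param → ℝ → ℝ} (hu : IsModerate u) (hw : IsModerate w) :
    IsModerate fun ε t => u ε t - w ε t :=
  (moderateNets.sub_mem hu hw : (u - w) ∈ moderateNets)

theorem GenFun.mk_eq_iff_negligibleOn (u w : moderateNets) : GenFun.mk u = GenFun.mk w ↔
    ∀ K, IsCompact K → NegligibleOn K fun ε t => u.1 ε t - w.1 ε t := by
  rw [GenFun.mk_eq_iff]
  refine ⟨fun h K hK => by simpa using h K hK 0, fun h => ?_⟩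
  exact isNegligible_of_negligibleOn (isModerate_sub u.2 w.2) h

theorem GenFun.exists_rep (g : GenFun) : ∃ u : moderateNets, GenFun.mk u = g :=
  Ideal.Quotient.mk_surjective g

/-! ### Differential algebra structure -/

theorem moderateNets_differentiable (u : moderateNets) (ε : Param) : Differentiable ℝ (u.1 ε) :=
  ((moderateNets_prop u).1 ε).differentiable (by simp)

namespace GenFun

theorem D_add (g h : GenFun) : D (g + h) = D g + D h := by
  obtain ⟨u, rfl⟩ := exists_rep g
  obtain ⟨w, rfl⟩ := exists_rep h
  change GenFun.mk (derivNet (u + w)) = GenFun.mk (derivNet u + derivNet w)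
  congr 1
  apply Subtype.ext
  funext ε t
  exact deriv_add (moderateNets_differentiable u ε t) (moderateNets_differentiable w ε t)

theorem D_mul (g h : GenFun) : D (g * h) = D g * h + g * D h := by
  obtain ⟨u, rfl⟩ := exists_rep g
  obtain ⟨w, rfl⟩ := exists_rep h
  change GenFun.mk (derivNet (u * w)) = GenFun.mk (derivNet u * w + u * derivNet w)
  congr 1
  apply Subtype.ext
  funext ε t
  exact deriv_mul (moderateNets_differentiable u ε t) (moderateNets_differentiable w ε t)

theorem D_algebraMap (c : ℝ) : D (algebraMap ℝ GenFun c) = 0 := by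
  change D (GenFun.mk (algebraMap ℝ moderateNets c)) = GenFun.mk 0
  rw [D_mk]
  congr 1
  apply Subtype.ext
  funext ε t
  exact deriv_const t c

theorem D_sub (g h : GenFun) : D (g - h) = D g - D h := by
  have e := D_add (g - h) h
  rw [sub_add_cancel] at e
  rw [e, add_sub_cancel_right]

theorem D_zero : D 0 = 0 := by
  simpa using D_sub 0 0

theorem D_one : D 1 = 0 := by
  simpa using D_algebraMap 1

theorem D_two : D 2 = 0 := by
  rw [← one_add_one_eq_two, D_add, D_one, add_zero]

theorem at_add (g h : GenFun) (t : ℝ) : (g + h).at t = g.at t + h.at t := by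
  obtain ⟨u, rfl⟩ := exists_rep g
  obtain ⟨w, rfl⟩ := exists_rep h
  rfl

theorem at_sub (g h : GenFun) (t : ℝ) : (g - h).at t = g.at t - h.at t := by
  obtain ⟨u, rfl⟩ := exists_rep g
  obtain ⟨w, rfl⟩ := exists_rep h
  rfl

theorem at_mul (g h : GenFun) (t : ℝ) : (g * h).at t = g.at t * h.at t := by
  obtain ⟨u, rfl⟩ := exists_rep g
  obtain ⟨w, rfl⟩ := exists_rep h
  rfl

end GenFun

/-! ### Smooth functions as generalized functions -/

/-- The net that is constantly equal to a smooth function. -/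
def constNet (f : SmoothLine) : moderateNets :=
  ⟨fun _ => f.1, fun _ => f.2, fun K hK n => by
    obtain ⟨B, hB⟩ := hK.exists_bound_of_continuousOn
      (f.2.continuous_iteratedDeriv n (by exact_mod_cast le_top)).continuousOn
    exact moderateOn_of_bounded B (Eventually.of_forall fun _ t ht => hB t ht)⟩

/-- The affine function `t ↦ a + b (1 + t)`. -/
def affineLine (a b : ℝ) : SmoothLine := ⟨fun t => a + b * (1 + t), by fun_prop⟩

theorem deriv_affineLine (a b : ℝ) : deriv (affineLine a b).1 = fun _ => b := by
  funext t
  have : HasDerivAt (fun t : ℝ => a + b * (1 + t)) b t := by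
    simpa using (((hasDerivAt_id t).const_add (1 : ℝ)).const_mul b).const_add a
  exact this.deriv

theorem D_D_affine (a b : ℝ) : GenFun.D (GenFun.D (GenFun.mk (constNet (affineLine a b)))) = 0 := by
  change GenFun.mk (derivNet (derivNet (constNet (affineLine a b)))) = GenFun.mk 0
  congr 1
  apply Subtype.ext
  funext ε t
  change deriv (deriv (affineLine a b).1) t = 0
  rw [deriv_affineLine]
  exact deriv_const t b

theorem at_affine (a b : ℝ) :
    (GenFun.mk (constNet (affineLine a b))).at (-1) = algebraMap ℝ GenNum a := by
  change GenNum.mk (evalNet (-1) (constNet (affineLine a b))) =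
    GenNum.mk (algebraMap ℝ moderateNumbers a)
  congr 1
  apply Subtype.ext
  funext ε
  change a + b * (1 + -1) = a
  ring

theorem at_D_affine (a b : ℝ) :
    (GenFun.D (GenFun.mk (constNet (affineLine a b)))).at (-1) = algebraMap ℝ GenNum b := by
  change GenNum.mk (evalNet (-1) (derivNet (constNet (affineLine a b)))) =
    GenNum.mk (algebraMap ℝ moderateNumbers b)
  congr 1
  apply Subtype.ext
  funext ε
  change deriv (affineLine a b).1 (-1) = b
  rw [deriv_affineLine]

/-! ### Composition -/

theorem locallyBoundedNet_comp (f : SmoothLine) {u : Param → ℝ → ℝ} (hu : LocallyBoundedNet u) :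
    LocallyBoundedNet fun ε t => f.1 (u ε t) := by
  intro K hK
  obtain ⟨C, hC⟩ := hu K hK
  obtain ⟨B, hB⟩ := (isCompact_Icc (a := -C) (b := C)).exists_bound_of_continuousOn
    f.2.continuous.continuousOn
  exact ⟨B, hC.mono fun ε hε t ht => hB _ (abs_le.1 (hε t ht))⟩

/-- The net `f(u_ε)`. -/
def lineCompNet (f : SmoothLine) (u : moderateNets) (bu : LocallyBoundedNet u.1) : moderateNets :=
  compNet ⟨fun p => f.1 p.1, f.2.comp contDiff_fst⟩ u u bu bu

theorem SmoothLine.comp_eq (f : SmoothLine) (x : LBGenFun) :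
    f.comp x = GenFun.mk (lineCompNet f x.rep x.bounded_rep) := rfl

theorem SmoothLine.D_comp (f : SmoothLine) (x : LBGenFun) :
    GenFun.D (f.comp x) = f.d.comp x * GenFun.D x.1 := by
  conv_rhs => rw [← x.mk_rep]
  change GenFun.mk (derivNet (lineCompNet f x.rep x.bounded_rep)) =
    GenFun.mk (lineCompNet f.d x.rep x.bounded_rep * derivNet x.rep)
  congr 1
  apply Subtype.ext
  funext ε t
  exact ((f.2.differentiable (by simp) _).hasDerivAt.comp t
    (moderateNets_differentiable x.rep ε t).hasDerivAt).deriv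

/-! ### Impulsive equations -/

/-- A net representing a generalized delta function. -/
structure IsDeltaNet (r : moderateNets) : Prop where
  tsupport_subset : ∀ ε : Param, tsupport (r.1 ε) ⊆ Set.Icc (-(ε : ℝ)) ε
  tendsto_integral : Tendsto (fun ε : Param => ∫ t, r.1 ε t) toZero (𝓝 1)
  exists_integral_abs_le : ∃ C : ℝ, ∀ᶠ ε in toZero, ∫ t, |r.1 ε t| ≤ C

namespace IsDeltaNet

variable {r : moderateNets} (hr : IsDeltaNet r)
include hr

theorem eq_zero_of_notMem (ε : Param) {t : ℝ} (ht : t ∉ Set.Icc (-(ε : ℝ)) ε) : r.1 ε t = 0 :=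
  image_eq_zero_of_notMem_tsupport fun h => ht (hr.tsupport_subset ε h)

/-- The support of a continuous function is open, hence misses the endpoints. The half-open form is
what identifies interval integrals with integrals over the line. -/
theorem support_subset_Ioc (ε : Param) : Function.support (r.1 ε) ⊆ Set.Ioc (-(ε : ℝ)) ε := by
  have hc := (moderateNets_prop r).1 ε |>.continuous
  have h1 : Function.support (r.1 ε) ⊆ interior (Set.Icc (-(ε : ℝ)) ε) :=
    hc.isOpen_support.subset_interior_iff.2 ((subset_tsupport _).trans (hr.tsupport_subset ε))
  rw [interior_Icc] at h1
  exact h1.trans Set.Ioo_subset_Ioc_self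

theorem intervalIntegral_abs (ε : Param) :
    ∫ t in (-(ε : ℝ))..ε, |r.1 ε t| = ∫ t, |r.1 ε t| :=
  intervalIntegral.integral_eq_integral_of_support_subset fun t ht =>
    hr.support_subset_Ioc ε (by simpa using ht)

/-- The order of quantifiers matters: neither B nor the threshold for ε depends on w or m, so the
bound applies to nets not yet known to be moderate. -/
theorem exists_bound (T D : ℝ) (hT : 1 ≤ T) : ∃ B : ℝ, 0 ≤ B ∧ ∀ᶠ ε in toZero,
    ∀ (w : ℝ → ℝ) (m : ℝ), ContDiff ℝ ∞ w → |w (-1)| ≤ m → |deriv w (-1)| ≤ m →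
      (∀ t ∈ Set.Icc (-T) T, |deriv (deriv w) t| ≤ D * |r.1 ε t| * |w t| + m) →
      ∀ t ∈ Set.Icc (-T) T, |w t| ≤ B * m ∧ |deriv w t| ≤ B * m := by
  obtain ⟨C, hC⟩ := hr.exists_integral_abs_le
  obtain ⟨B, hB, H⟩ := exists_bound_of_impulsive_inequality T (|D| * |C|) hT (by positivity)
  refine ⟨B, hB, ?_⟩
  have hδ : 0 < (4 * (|D| * |C|) + 1)⁻¹ := by positivity
  filter_upwards [hC, eventually_toZero_lt hδ] with ε hε hεδ w m hw h0 h1 h2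
  have hrc : Continuous (r.1 ε) := ((moderateNets_prop r).1 ε).continuous
  have hε0 : (0 : ℝ) < ε := ε.2.1
  refine H ε w (fun t => |D| * |r.1 ε t|) m ε.2.1 ε.2.2 ?_ hw (by fun_prop)
    (fun t => by positivity) (fun t ht => by simp [hr.eq_zero_of_notMem ε ht]) ?_ h0 h1
    fun t ht => (h2 t ht).trans ?_
  · rw [lt_inv_comm₀ hε0 (by positivity), ← one_div, lt_div_iff₀ hε0] at hεδ
    linarith
  · rw [intervalIntegral.integral_const_mul, hr.intervalIntegral_abs]
    exact mul_le_mul_of_nonneg_left (hε.trans (le_abs_self C)) (abs_nonneg D)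
  · gcongr
    exact le_abs_self D

/-- The a priori bound is linear in m, and here m can be taken O(ε^M) for each M. Assuming an
inequality instead of an equation lets the same lemma serve the nonlinear equation for y. -/
theorem eq_zero_of_abs_deriv_deriv_le (w : moderateNets) (n : Param → ℝ → ℝ)
    (hn : ∀ K, IsCompact K → NegligibleOn K n)
    (h : ∀ T : ℝ, 1 ≤ T → ∃ D : ℝ, ∀ᶠ ε in toZero, ∀ t ∈ Set.Icc (-T) T,
      |deriv (deriv (w.1 ε)) t| ≤ D * |r.1 ε t| * |w.1 ε t| + |n ε t|)
    (h0 : (GenFun.mk w).at (-1) = 0) (h1 : (GenFun.D (GenFun.mk w)).at (-1) = 0) :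
    GenFun.mk w = 0 := by
  have e0 := (GenNum.mk_eq_iff (evalNet (-1) w) 0).1 h0
  have e1 := (GenNum.mk_eq_iff (evalNet (-1) (derivNet w)) 0).1 h1
  change GenFun.mk w = GenFun.mk 0
  rw [GenFun.mk_eq_iff_negligibleOn]
  intro K hK M
  obtain ⟨T, hT, hKT⟩ := exists_subset_Icc hK
  obtain ⟨D, hD⟩ := h T hT
  obtain ⟨B, hB, H⟩ := hr.exists_bound T D hT
  obtain ⟨C0, hC0, g0⟩ := e0.exists_nonneg M
  obtain ⟨C1, hC1, g1⟩ := e1.exists_nonneg M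
  obtain ⟨C2, hC2, g2⟩ := (hn _ (isCompact_Icc (a := -T) (b := T))).exists_nonneg M
  refine ⟨B * (C0 + C1 + C2), ?_⟩
  filter_upwards [hD, H, g0, g1, g2] with ε hDε Hε k0 k1 k2 t ht
  have hε : (0 : ℝ) < ε := ε.2.1
  have hp : 0 ≤ (ε : ℝ) ^ M := by positivity
  have j0 : |w.1 ε (-1)| ≤ C0 * (ε : ℝ) ^ M := by simpa [evalNet] using k0 () trivial
  have j1 : |deriv (w.1 ε) (-1)| ≤ C1 * (ε : ℝ) ^ M := by
    simpa [evalNet, derivNet] using k1 () trivial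
  have m0 := mul_nonneg hC0 hp
  have m1 := mul_nonneg hC1 hp
  have m2 := mul_nonneg hC2 hp
  have := (Hε (w.1 ε) ((C0 + C1 + C2) * (ε : ℝ) ^ M) ((moderateNets_prop w).1 ε) (by linarith)
    (by linarith) (fun s hs => (hDε s hs).trans (by linarith [k2 s hs])) t (hKT ht)).1
  simpa [mul_assoc] using this

theorem exists_solution (c : moderateNets) (hc : LocallyBoundedNet c.1) (p₀ p₁ : GenNum) :
    ∃ P : GenFun, GenFun.D (GenFun.D P) = GenFun.mk c * GenFun.mk r * P ∧
      P.at (-1) = p₀ ∧ (GenFun.D P).at (-1) = p₁ := by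
  obtain ⟨a₀, rfl⟩ := Ideal.Quotient.mk_surjective p₀
  obtain ⟨a₁, rfl⟩ := Ideal.Quotient.mk_surjective p₁
  -- A solution is obtained by contraction only for small ε; otherwise the zero function may serve,
  -- so that the net is smooth for every ε.
  have ex : ∀ ε : Param, ∃ P : ℝ → ℝ, ContDiff ℝ ∞ P ∧
      ((∃ P : ℝ → ℝ, ContDiff ℝ ∞ P ∧ (∀ t, deriv (deriv P) t = c.1 ε t * r.1 ε t * P t) ∧
        P (-1) = a₀.1 ε ∧ deriv P (-1) = a₁.1 ε) →
      (∀ t, deriv (deriv P) t = c.1 ε t * r.1 ε t * P t) ∧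
        P (-1) = a₀.1 ε ∧ deriv P (-1) = a₁.1 ε) := by
    intro ε
    by_cases h : ∃ P : ℝ → ℝ, ContDiff ℝ ∞ P ∧
        (∀ t, deriv (deriv P) t = c.1 ε t * r.1 ε t * P t) ∧
        P (-1) = a₀.1 ε ∧ deriv P (-1) = a₁.1 ε
    · obtain ⟨P, hP, hP'⟩ := h
      exact ⟨P, hP, fun _ => hP'⟩
    · exact ⟨0, contDiff_const, fun h' => absurd h' h⟩
  choose P hP hP' using ex
  obtain ⟨C, hC⟩ := hr.exists_integral_abs_le
  obtain ⟨E, hE⟩ := hc (Set.Icc (-1) 1) isCompact_Icc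
  have hδ : 0 < (4 * (|E| * |C|) + 1)⁻¹ := by positivity
  have good : ∀ᶠ ε in toZero, (∀ t, deriv (deriv (P ε)) t = c.1 ε t * r.1 ε t * P ε t) ∧
      P ε (-1) = a₀.1 ε ∧ deriv (P ε) (-1) = a₁.1 ε := by
    filter_upwards [hC, hE, eventually_toZero_lt hδ] with ε h1 h2 hεδ
    have hε0 : (0 : ℝ) < ε := ε.2.1
    have hε1 : (ε : ℝ) < 1 := ε.2.2
    have hrs := (moderateNets_prop r).1 ε
    have hcs := (moderateNets_prop c).1 ε
    refine hP' ε (exists_solution_of_impulsive_equation (C := |E| * |C|) ε.2.1 ε.2.2 ?_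
      (hcs.mul hrs) (fun t ht => by simp [hr.eq_zero_of_notMem ε ht]) ?_ _ _)
    · rw [lt_inv_comm₀ hε0 (by positivity), ← one_div, lt_div_iff₀ hε0] at hεδ
      linarith
    · have hrc : Continuous (r.1 ε) := hrs.continuous
      have hcc : Continuous (c.1 ε) := hcs.continuous
      calc ∫ t in (-(ε : ℝ))..ε, |c.1 ε t * r.1 ε t|
          ≤ ∫ t in (-(ε : ℝ))..ε, |E| * |r.1 ε t| := by
            refine intervalIntegral.integral_mono_on (by linarith)
              ((hcc.mul hrc).abs.intervalIntegrable _ _)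
              ((continuous_const.mul hrc.abs).intervalIntegrable _ _) fun t ht => ?_
            rw [abs_mul]
            exact mul_le_mul_of_nonneg_right
              ((h2 t ⟨by linarith [ht.1], by linarith [ht.2]⟩).trans (le_abs_self E)) (abs_nonneg _)
        _ ≤ |E| * |C| := by
            rw [intervalIntegral.integral_const_mul, hr.intervalIntegral_abs]
            exact mul_le_mul_of_nonneg_left (h1.trans (le_abs_self C)) (abs_nonneg E)
  have base : ∀ K, IsCompact K →
      ModerateOn K (fun ε t => P ε t) ∧ ModerateOn K (fun ε t => deriv (P ε) t) := by
    intro K hK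
    obtain ⟨T, hT, hKT⟩ := exists_subset_Icc hK
    obtain ⟨D, hD⟩ := hc (Set.Icc (-T) T) isCompact_Icc
    obtain ⟨B, hB, H⟩ := hr.exists_bound T D hT
    have b0 : ModerateOn Set.univ (fun ε (_ : Unit) => a₀.1 ε) := a₀.2
    have b1 : ModerateOn Set.univ (fun ε (_ : Unit) => a₁.1 ε) := a₁.2
    obtain ⟨N, A, hA, hN⟩ := (ModerateOn.add (p := fun ε (_ : Unit) => |a₀.1 ε|)
      (q := fun ε _ => |a₁.1 ε|) (K := Set.univ) (by simpa [ModerateOn] using b0)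
      (by simpa [ModerateOn] using b1)).exists_nonneg
    have key : ∀ᶠ ε in toZero, ∀ t ∈ K, |P ε t| ≤ B * A * ((ε : ℝ) ^ N)⁻¹ ∧
        |deriv (P ε) t| ≤ B * A * ((ε : ℝ) ^ N)⁻¹ := by
      filter_upwards [good, hD, H, hN] with ε ⟨g1, g2, g3⟩ hDε Hε hNε t ht
      have hs := hNε () trivial
      rw [abs_of_nonneg (by positivity)] at hs
      have hm : 0 ≤ A * ((ε : ℝ) ^ N)⁻¹ := le_trans (by positivity) hs
      have := Hε (P ε) (A * ((ε : ℝ) ^ N)⁻¹) (hP ε)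
        (by rw [g2]; linarith [abs_nonneg (a₁.1 ε)]) (by rw [g3]; linarith [abs_nonneg (a₀.1 ε)])
        (fun s hs => by
          rw [g1, abs_mul, abs_mul]
          have := mul_le_mul_of_nonneg_right (mul_le_mul_of_nonneg_right (hDε s hs)
            (abs_nonneg (r.1 ε s))) (abs_nonneg (P ε s))
          linarith) t (hKT ht)
      simpa only [mul_assoc] using this
    exact ⟨⟨N, B * A, key.mono fun ε h t ht => (h t ht).1⟩,
      ⟨N, B * A, key.mono fun ε h t ht => (h t ht).2⟩⟩
  -- Orders 0 and 1 come from the a priori bound; each higher order follows from the equation and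
  -- the Leibniz rule, two orders down.
  have hmod : IsModerate P := by
    refine ⟨hP, fun K hK n => ?_⟩
    induction n using Nat.strong_induction_on with
    | _ n ih =>
      match n, ih with
      | 0, _ => simpa using (base K hK).1
      | 1, _ => simpa using (base K hK).2
      | n + 2, ih =>
        obtain ⟨N, A, hN⟩ := moderateOn_iteratedDeriv_mul (c * r).2.1 hP n
          (fun i _ => (c * r).2.2 K hK i) fun i hi => ih i (by omega)
        refine ⟨N, A, ?_⟩
        filter_upwards [good, hN] with ε ⟨g1, _, _⟩ h t ht
        have e : deriv (deriv (P ε)) = fun s => (c * r).1 ε s * P ε s := funext g1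
        rw [iteratedDeriv_succ', iteratedDeriv_succ', e]
        exact h t ht
  refine ⟨GenFun.mk ⟨P, hmod⟩, ?_, ?_, ?_⟩
  · change GenFun.mk (derivNet (derivNet ⟨P, hmod⟩)) = GenFun.mk (c * r * ⟨P, hmod⟩)
    rw [GenFun.mk_eq_iff_negligibleOn]
    refine fun K hK M => ⟨0, good.mono fun ε h t ht => ?_⟩
    have : deriv (deriv (P ε)) t - c.1 ε t * r.1 ε t * P ε t = 0 := sub_eq_zero.2 (h.1 t)
    change |deriv (deriv (P ε)) t - c.1 ε t * r.1 ε t * P ε t| ≤ _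
    simp [this]
  · refine (GenNum.mk_eq_iff (evalNet (-1) ⟨P, hmod⟩) a₀).2 fun M => ⟨0, good.mono fun ε h t ht => ?_⟩
    simp [evalNet, h.2.1]
  · refine (GenNum.mk_eq_iff (evalNet (-1) (derivNet ⟨P, hmod⟩)) a₁).2 fun M =>
      ⟨0, good.mono fun ε h t ht => ?_⟩
    simp [evalNet, derivNet, h.2.2]

/-- A representative solves the equation only up to a negligible defect, which plays the role of the
inhomogeneity. -/
theorem eq_zero_of_impulsive (c : moderateNets) (hc : LocallyBoundedNet c.1) (P : GenFun)
    (hP : GenFun.D (GenFun.D P) = GenFun.mk c * GenFun.mk r * P)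
    (h0 : P.at (-1) = 0) (h1 : (GenFun.D P).at (-1) = 0) : P = 0 := by
  obtain ⟨w, rfl⟩ := P.exists_rep
  have e := (GenFun.mk_eq_iff_negligibleOn (derivNet (derivNet w)) (c * r * w)).1 hP
  refine hr.eq_zero_of_abs_deriv_deriv_le w _ e (fun T hT => ?_) h0 h1
  obtain ⟨D, hD⟩ := hc (Set.Icc (-T) T) isCompact_Icc
  refine ⟨D, hD.mono fun ε h t ht => ?_⟩
  change |deriv (deriv (w.1 ε)) t| ≤ D * |r.1 ε t| * |w.1 ε t| +
    |deriv (deriv (w.1 ε)) t - c.1 ε t * r.1 ε t * w.1 ε t|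
  have a1 := abs_sub_abs_le_abs_sub (deriv (deriv (w.1 ε)) t) (c.1 ε t * r.1 ε t * w.1 ε t)
  rw [abs_mul, abs_mul] at a1
  have := mul_le_mul_of_nonneg_right (mul_le_mul_of_nonneg_right (h t ht)
            (abs_nonneg (r.1 ε t))) (abs_nonneg (w.1 ε t))
  linarith

theorem at_neg_one : (GenFun.mk r).at (-1) = 0 := by
  refine (GenNum.mk_eq_iff (evalNet (-1) r) 0).2 fun M => ⟨0, Eventually.of_forall fun ε t ht => ?_⟩
  have : r.1 ε (-1) = 0 := hr.eq_zero_of_notMem ε fun h => by linarith [h.1, ε.2.2]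
  simp [evalNet, this]

theorem at_D_neg_one : (GenFun.D (GenFun.mk r)).at (-1) = 0 := by
  refine (GenNum.mk_eq_iff (evalNet (-1) (derivNet r)) 0).2 fun M =>
    ⟨0, Eventually.of_forall fun ε t ht => ?_⟩
  have : deriv (r.1 ε) (-1) = 0 := by
    have h1 : r.1 ε =ᶠ[𝓝 (-1)] fun _ => 0 :=
      notMem_tsupport_iff_eventuallyEq.1 fun h => by
        linarith [(hr.tsupport_subset ε h).1, ε.2.2]
    rw [h1.deriv_eq, deriv_const]
  simp [evalNet, derivNet, this]

end IsDeltaNet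

theorem locallyBoundedNet_zero : LocallyBoundedNet (0 : moderateNets).1 :=
  fun K _ => ⟨0, by simp⟩

namespace IsDeltaNet

variable {r : moderateNets} (hr : IsDeltaNet r)
include hr

theorem eq_of_impulsive (c : moderateNets) (hc : LocallyBoundedNet c.1) {P Q : GenFun}
    (hP : GenFun.D (GenFun.D P) = GenFun.mk c * GenFun.mk r * P)
    (hQ : GenFun.D (GenFun.D Q) = GenFun.mk c * GenFun.mk r * Q)
    (h0 : P.at (-1) = Q.at (-1)) (h1 : (GenFun.D P).at (-1) = (GenFun.D Q).at (-1)) : P = Q := by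
  refine sub_eq_zero.1 (hr.eq_zero_of_impulsive c hc (P - Q) ?_ ?_ ?_)
  · rw [GenFun.D_sub, GenFun.D_sub, hP, hQ, mul_sub]
  · rw [GenFun.at_sub, h0, sub_self]
  · rw [GenFun.D_sub, GenFun.at_sub, h1, sub_self]

/-- The free equation is the impulsive one with coefficient 0. -/
theorem eq_of_D_D_eq_zero {P Q : GenFun} (hP : GenFun.D (GenFun.D P) = 0)
    (hQ : GenFun.D (GenFun.D Q) = 0) (h0 : P.at (-1) = Q.at (-1))
    (h1 : (GenFun.D P).at (-1) = (GenFun.D Q).at (-1)) : P = Q := by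
  have z : GenFun.mk 0 = 0 := rfl
  exact hr.eq_of_impulsive 0 locallyBoundedNet_zero (by rw [hP, z, zero_mul, zero_mul])
    (by rw [hQ, z, zero_mul, zero_mul]) h0 h1

theorem exists_D_D_eq_zero (p₀ p₁ : GenNum) :
    ∃ P : GenFun, GenFun.D (GenFun.D P) = 0 ∧ P.at (-1) = p₀ ∧ (GenFun.D P).at (-1) = p₁ := by
  obtain ⟨P, h, h'⟩ := hr.exists_solution 0 locallyBoundedNet_zero p₀ p₁
  have z : GenFun.mk 0 = 0 := rfl
  exact ⟨P, by rw [h, z, zero_mul, zero_mul], h'⟩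

end IsDeltaNet

/-! ### The geodesic stays in the hypersurface `y = 0` -/

/-- F is even in y, and an even function has zero derivative at 0. -/
theorem SmoothPlane.IsAxisymmetric.dy_eq_zero {F : SmoothPlane} (hF : F.IsAxisymmetric) (s : ℝ) :
    F.dy.1 (s, 0) = 0 := by
  have h3 : HasFDerivAt F.1 (fderiv ℝ F.1 (s, 0)) (s, 0) :=
    (F.2.differentiable (by simp) (s, 0)).hasFDerivAt
  have h4 : HasDerivAt (fun t => F.1 (s, t)) (F.dy.1 (s, 0)) 0 :=
    h3.comp_hasDerivAt 0 ((hasDerivAt_const (0 : ℝ) s).prodMk (hasDerivAt_id (0 : ℝ)))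
  have e : (fun t => F.1 (s, -t)) = fun t => F.1 (s, t) := funext fun t => hF _ _ (by simp)
  have h5 := deriv_comp_neg (fun t => F.1 (s, t)) 0
  rw [e, neg_zero, h4.deriv] at h5
  linarith

theorem SmoothPlane.dx_eq_deriv_profile (F : SmoothPlane) (s : ℝ) :
    F.dx.1 (s, 0) = F.profile.d.1 s := by
  have h3 : HasFDerivAt F.1 (fderiv ℝ F.1 (s, 0)) (s, 0) :=
    (F.2.differentiable (by simp) (s, 0)).hasFDerivAt
  have h4 : HasDerivAt (fun t => F.1 (t, 0)) (F.dx.1 (s, 0)) s :=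
    h3.comp_hasDerivAt s ((hasDerivAt_id s).prodMk (hasDerivAt_const s (0 : ℝ)))
  exact h4.deriv.symm

/-- Mean value inequality from (s, 0) to (s, t) in a compact rectangle. With G = ∂_yF it turns the
nonlinear equation for y into a linear impulsive inequality. -/
theorem SmoothPlane.abs_le_of_eq_zero_on_axis (G : SmoothPlane) (hG : ∀ s, G.1 (s, 0) = 0)
    (A B : ℝ) : ∃ L : ℝ, ∀ s t : ℝ, |s| ≤ A → |t| ≤ B → |G.1 (s, t)| ≤ L * |t| := by
  obtain ⟨L, hL⟩ := ((isCompact_Icc (a := -A) (b := A)).prod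
    (isCompact_Icc (a := -B) (b := B))).exists_bound_of_continuousOn
      (G.2.continuous_fderiv (by simp)).continuousOn
  refine ⟨L, fun s t hs ht => ?_⟩
  have hcv : Convex ℝ (Set.Icc (-A) A ×ˢ Set.Icc (-B) B) := (convex_Icc _ _).prod (convex_Icc _ _)
  have m1 : (s, t) ∈ Set.Icc (-A) A ×ˢ Set.Icc (-B) B := ⟨abs_le.1 hs, abs_le.1 ht⟩
  have m2 : (s, (0 : ℝ)) ∈ Set.Icc (-A) A ×ˢ Set.Icc (-B) B :=
    ⟨abs_le.1 hs, abs_le.1 (by simpa using (abs_nonneg t).trans ht)⟩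
  have := hcv.norm_image_sub_le_of_norm_fderiv_le (𝕜 := ℝ)
    (fun p _ => G.2.differentiable (by simp) p) hL m2 m1
  simpa [hG, Prod.norm_mk] using this

/-- Local boundedness of x and y keeps the orbit in a fixed rectangle for small ε, where |ÿ| ≤
L|ρ||y| up to a negligible term; zero data then force y = 0. -/
theorem IsGeodesic.y_eq_zero {F : SmoothPlane} (hF : F.IsAxisymmetric) {r : moderateNets}
    (hr : IsDeltaNet r) {v x y : LBGenFun} (hγ : IsGeodesic F (GenFun.mk r) v x y)
    (hy : y.1.at (-1) = 0) (hy' : (GenFun.D y.1).at (-1) = 0) : y.1 = 0 := by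
  rw [← y.mk_rep] at hy hy' ⊢
  have hode := hγ.eq_y
  rw [← y.mk_rep] at hode
  have e := (GenFun.mk_eq_iff_negligibleOn (derivNet (derivNet y.rep))
    ((1 / 2 : ℝ) • (compNet F.dy x.rep y.rep x.bounded_rep y.bounded_rep * r))).1 hode
  refine hr.eq_zero_of_abs_deriv_deriv_le y.rep _ e (fun T hT => ?_) hy hy'
  obtain ⟨A, hA⟩ := x.bounded_rep (Set.Icc (-T) T) isCompact_Icc
  obtain ⟨B, hB⟩ := y.bounded_rep (Set.Icc (-T) T) isCompact_Icc
  obtain ⟨L, hL⟩ := F.dy.abs_le_of_eq_zero_on_axis hF.dy_eq_zero A B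
  refine ⟨|L|, ?_⟩
  filter_upwards [hA, hB] with ε hAε hBε t ht
  change |deriv (deriv (y.rep.1 ε)) t| ≤ |L| * |r.1 ε t| * |y.rep.1 ε t| +
    |deriv (deriv (y.rep.1 ε)) t -
      1 / 2 * (F.dy.1 (x.rep.1 ε t, y.rep.1 ε t) * r.1 ε t)|
  have a1 := abs_sub_abs_le_abs_sub (deriv (deriv (y.rep.1 ε)) t)
    (1 / 2 * (F.dy.1 (x.rep.1 ε t, y.rep.1 ε t) * r.1 ε t))
  rw [abs_mul, abs_mul, abs_of_pos (by norm_num : (0 : ℝ) < 1 / 2)] at a1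
  have a2 := (hL _ _ (hAε t ht) (hBε t ht)).trans
    (mul_le_mul_of_nonneg_right (le_abs_self L) (abs_nonneg _))
  have a3 := mul_le_mul_of_nonneg_right a2 (abs_nonneg (r.1 ε t))
  have a4 : 0 ≤ |L| * |r.1 ε t| * |y.rep.1 ε t| := by positivity
  linarith

/-- The generalized number `1/2` as a constant generalized function. -/
noncomputable def GenFun.half : GenFun := algebraMap ℝ GenFun (1 / 2)

/-- The only relation needed to treat the scalar 1/2 as a ring element in the `linear_combination`
certificates. -/
theorem GenFun.two_mul_half : 2 * GenFun.half = 1 := by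
  have h : (2 : GenFun) = algebraMap ℝ GenFun 2 := (map_ofNat _ 2).symm
  rw [h, GenFun.half, ← map_mul, ← map_one (algebraMap ℝ GenFun)]
  norm_num

theorem GenFun.half_smul (g : GenFun) : (1 / 2 : ℝ) • g = GenFun.half * g := by
  obtain ⟨u, rfl⟩ := g.exists_rep
  exact congrArg GenFun.mk (Algebra.smul_def (1 / 2 : ℝ) u)

theorem GenFun.D_half : GenFun.D GenFun.half = 0 := GenFun.D_algebraMap _

/-- Composition is independent of representatives, so y may be represented by the zero net. -/
theorem IsGeodesic.eq_x_of_y_eq_zero {F : SmoothPlane} {ρ : GenFun} {v x y : LBGenFun}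
    (hγ : IsGeodesic F ρ v x y) (hy : y.1 = 0) :
    GenFun.D (GenFun.D x.1) = GenFun.half * (F.profile.d.comp x * ρ) := by
  rw [hγ.eq_x, GenFun.half_smul]
  congr 2
  rw [F.dx.comp_eq_mk x y x.rep 0 x.bounded_rep locallyBoundedNet_zero x.mk_rep hy.symm,
    SmoothLine.comp_eq]
  congr 1
  apply Subtype.ext
  funext ε t
  exact F.dx_eq_deriv_profile (x.rep.1 ε t)

/-! ### Decoupling the Jacobi equation -/

-- Since (ẋ)¨ = ½(f''(x) ẋ ρ + f'(x) ρ̇), subtracting ẋ N^u removes the ρ̇ term and all dependence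
-- on N^u. The combination formed from N^v equals -2⟨γ̇, N⟩ - v̇₀ N^u on the geodesic, and the inner
-- product of a Jacobi field with the velocity is affine; the proof verifies the vanishing second
-- derivative by computation.
open GenFun in
theorem isJacobiField_iff {f : SmoothLine} {ρ : GenFun} {x : LBGenFun} {N : Fin 4 → GenFun}
    (hx : D (D x.1) = half * (f.d.comp x * ρ)) :
    IsJacobiField f ρ x N ↔ D (D (N 0)) = 0 ∧ D (D (N 3)) = 0 ∧
      D (D (N 2 - D x.1 * N 0)) = half * f.d.d.comp x * ρ * (N 2 - D x.1 * N 0) ∧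
      D (D (N 1 - (2 * (N 2 - D x.1 * N 0) * D x.1 + D x.1 ^ 2 * N 0 + N 0 * f.comp x * ρ))) =
        0 := by
  have h2 := two_mul_half
  have hxx : D (D (D x.1)) =
      half * (f.d.d.comp x * D x.1 * ρ + f.d.comp x * D ρ) := by
    rw [hx, D_mul, D_mul, D_half, SmoothLine.D_comp]
    ring
  -- Both keys equate residuals of the old and new equations, so each direction of the equivalence
  -- can be read off.
  have key1 : D (D (N 0)) = 0 →
      D (D (N 2 - D x.1 * N 0)) - half * f.d.d.comp x * ρ * (N 2 - D x.1 * N 0) =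
      D (D (N 2)) - ((D (N 0) * f.d.comp x + half * (N 2 * f.d.d.comp x)) * ρ +
        half * (f.d.comp x * N 0 * D ρ)) := by
    intro h0
    simp only [D_sub, D_mul, D_add, hxx, h0]
    rw [hx]
    linear_combination (-D (N 0) * f.d.comp x * ρ) * h2
  have key2 : D (D (N 0)) = 0 →
      D (D (N 2 - D x.1 * N 0)) = half * f.d.d.comp x * ρ * (N 2 - D x.1 * N 0) →
      D (D (N 1 - (2 * (N 2 - D x.1 * N 0) * D x.1 + D x.1 ^ 2 * N 0 + N 0 * f.comp x * ρ))) =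
      D (D (N 1)) - (2 * D (N 2 * f.d.comp x * ρ) - N 2 * f.d.comp x * D ρ +
        D (D (N 0 * f.comp x * ρ)) -
      N 0 * f.d.d.comp x * D x.1 ^ 2 * ρ - N 0 * f.d.comp x * D (D x.1) * ρ) := by
    intro h0 hP
    -- With P as the unknown, its equation can be used to eliminate P̈. The term N^u f(x) ρ is made
    -- opaque below because its second derivative cancels unexpanded.
    have e : N 2 = (N 2 - D x.1 * N 0) + D x.1 * N 0 := by ring
    generalize N 2 - D x.1 * N 0 = P at *
    rw [e, pow_two]
    generalize N 0 * f.comp x * ρ = G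
    simp only [D_sub, D_add, D_mul, D_two, SmoothLine.D_comp, hxx, h0, hP, zero_mul, mul_zero,
      zero_add, add_zero]
    simp only [hx]
    linear_combination (-(2 * P * f.d.d.comp x * D x.1 * ρ + 2 * D P * f.d.comp x * ρ +
      P * f.d.comp x * D ρ + half * f.d.comp x ^ 2 * ρ ^ 2 * N 0 +
      D x.1 ^ 2 * f.d.d.comp x * ρ * N 0 + D x.1 * N 0 * f.d.comp x * D ρ +
      2 * D x.1 * f.d.comp x * ρ * D (N 0))) * h2
  constructor
  · intro hN
    have k1 : D (D (N 2 - D x.1 * N 0)) =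
        half * f.d.d.comp x * ρ * (N 2 - D x.1 * N 0) := by
      rw [← sub_eq_zero, key1 hN.eq_u, hN.eq_x, half_smul, half_smul, sub_self]
    refine ⟨hN.eq_u, hN.eq_y, k1, ?_⟩
    rw [key2 hN.eq_u k1, hN.eq_v, sub_self]
  · rintro ⟨h0, h3, k1, k2⟩
    refine ⟨h0, h3, ?_, ?_⟩
    · rw [half_smul, half_smul, ← sub_eq_zero, ← key1 h0, k1, sub_self]
    · rw [← sub_eq_zero, ← key2 h0 k1, k2]

/-! ### Limits in the shrinking support of the impulse -/

/-- The filter on `(ε, t)` describing `ε → 0` with `|t| ≤ ε`. -/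
def nearZero : Filter (Param × ℝ) := comap Prod.fst toZero ⊓ 𝓟 {p | |p.2| ≤ p.1}

theorem eventually_nearZero_iff {p : Param × ℝ → Prop} :
    (∀ᶠ q in nearZero, p q) ↔ ∀ᶠ ε : Param in toZero, ∀ t : ℝ, |t| ≤ ε → p (ε, t) := by
  rw [nearZero, eventually_inf_principal, eventually_comap]
  refine eventually_congr (Eventually.of_forall fun ε => ?_)
  constructor
  · exact fun h t ht => h (ε, t) rfl ht
  · rintro h ⟨_, t⟩ rfl ht
    exact h t ht

theorem tendsto_coe_toZero : Tendsto (fun ε : Param => (ε : ℝ)) toZero (𝓝 0) := tendsto_comap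

theorem tendsto_snd_nearZero : Tendsto (fun q : Param × ℝ => q.2) nearZero (𝓝 0) := by
  rw [Metric.tendsto_nhds]
  intro δ hδ
  rw [eventually_nearZero_iff]
  filter_upwards [eventually_toZero_lt hδ] with ε hε t ht
  simpa using ht.trans_lt hε

theorem tendsto_nearZero_of_abs_sub_le {h : Param → ℝ → ℝ} {h₀ : ℝ} {b : Param → ℝ}
    (hb : Tendsto b toZero (𝓝 0)) (hh : ∀ᶠ ε : Param in toZero, ∀ t : ℝ, |t| ≤ ε → |h ε t - h₀| ≤ b ε) :
    Tendsto (fun q : Param × ℝ => h q.1 q.2) nearZero (𝓝 h₀) := by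
  rw [Metric.tendsto_nhds]
  intro δ hδ
  rw [eventually_nearZero_iff]
  filter_upwards [hh, hb.eventually (gt_mem_nhds hδ)] with ε h1 h2 t ht
  exact (h1 t ht).trans_lt h2

/-- Required by dominated convergence along this filter. -/
instance : toZero.IsCountablyGenerated := by
  unfold toZero; infer_instance

namespace IsDeltaNet

variable {r : moderateNets} (hr : IsDeltaNet r)
include hr

theorem integrable_mul (ε : Param) {H : ℝ → ℝ} (hH : Continuous H) :
    Integrable fun t => H t * r.1 ε t := by
  have hc := ((moderateNets_prop r).1 ε).continuous
  have hs : HasCompactSupport (r.1 ε) := isCompact_Icc.of_isClosed_subset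
    (isClosed_tsupport _) (hr.tsupport_subset ε)
  exact (hH.mul hc).integrable_of_hasCompactSupport hs.mul_left

/-- The error is at most the supremum of |H - H₀| over [-ε, ε] times the L¹ norm of ρ_ε. As ρ_ε may
change sign, its integral alone would not control this. -/
theorem tendsto_integral_mul {H : Param → ℝ → ℝ} {H₀ : ℝ} (hc : ∀ ε, Continuous (H ε))
    (hH : Tendsto (fun q : Param × ℝ => H q.1 q.2) nearZero (𝓝 H₀)) :
    Tendsto (fun ε : Param => ∫ t, H ε t * r.1 ε t) toZero (𝓝 H₀) := by
  obtain ⟨C, hC⟩ := hr.exists_integral_abs_le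
  have main : Tendsto (fun ε : Param => ∫ t, (H ε t - H₀) * r.1 ε t) toZero (𝓝 0) := by
    rw [Metric.tendsto_nhds]
    intro δ hδ
    have hη : 0 < δ / (|C| + 1) := by positivity
    have h1 := eventually_nearZero_iff.1 ((Metric.tendsto_nhds.1 hH) _ hη)
    filter_upwards [h1, hC] with ε h1 h2
    have hi : Integrable fun t => δ / (|C| + 1) * |r.1 ε t| := by
      have := (hr.integrable_mul ε (continuous_const (y := (1 : ℝ)))).abs.const_mul (δ / (|C| + 1))
      simpa using this
    have hle := norm_integral_le_of_norm_le hi (f := fun t => (H ε t - H₀) * r.1 ε t)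
      (Eventually.of_forall fun t => by
        rw [norm_mul, Real.norm_eq_abs (r.1 ε t)]
        by_cases ht : |t| ≤ ε
        · exact mul_le_mul_of_nonneg_right (h1 t ht).le (abs_nonneg _)
        · simp [hr.eq_zero_of_notMem ε fun h => ht (abs_le.2 h)])
    rw [integral_const_mul] at hle
    rw [dist_zero_right]
    refine hle.trans_lt ?_
    have : δ / (|C| + 1) * ∫ t, |r.1 ε t| ≤ δ / (|C| + 1) * |C| :=
      mul_le_mul_of_nonneg_left (h2.trans (le_abs_self C)) hη.le
    refine this.trans_lt ?_
    rw [div_mul_eq_mul_div, div_lt_iff₀ (by positivity)]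
    nlinarith [abs_nonneg C]
  have h2 := main.add (hr.tendsto_integral.const_mul H₀)
  rw [zero_add, mul_one] at h2
  refine h2.congr fun ε => ?_
  have i1 : Integrable fun t => (H ε t - H₀) * r.1 ε t :=
    hr.integrable_mul ε ((hc ε).sub continuous_const)
  have i2 : Integrable fun t => H₀ * r.1 ε t := hr.integrable_mul ε continuous_const
  rw [← integral_const_mul, ← integral_add i1 i2]
  congr 1
  funext t
  ring

end IsDeltaNet

/-! ### Solutions of impulsive equations in the limit -/

/-- A net `w` with `ẅ = h ρ` in `G(ℝ)` for a locally bounded net `h`, with `ẇ(-1) = 0` and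
`w(-1) = A`. -/
structure IsKicked (r h w : moderateNets) (A : ℝ) : Prop where
  isDeltaNet : IsDeltaNet r
  bounded : LocallyBoundedNet h.1
  eq : GenFun.D (GenFun.D (GenFun.mk w)) = GenFun.mk h * GenFun.mk r
  initial : (GenFun.mk w).at (-1) = algebraMap ℝ GenNum A
  initial_deriv : (GenFun.D (GenFun.mk w)).at (-1) = 0

namespace IsKicked

variable {r h w : moderateNets} {A : ℝ} (hw : IsKicked r h w A)
include hw

/-- From here on only the O(ε) consequence of negligibility is used. -/
theorem eventually_initial :
    ∃ C : ℝ, ∀ᶠ ε : Param in toZero, |w.1 ε (-1) - A| ≤ C * ε ∧ |deriv (w.1 ε) (-1)| ≤ C * ε := by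
  have e0 := (GenNum.mk_eq_iff (evalNet (-1) w) (algebraMap ℝ moderateNumbers A)).1 hw.initial
  have e1 := (GenNum.mk_eq_iff (evalNet (-1) (derivNet w)) 0).1 hw.initial_deriv
  obtain ⟨C0, hC0, g0⟩ := e0.exists_nonneg 1
  obtain ⟨C1, hC1, g1⟩ := e1.exists_nonneg 1
  refine ⟨C0 + C1, ?_⟩
  filter_upwards [g0, g1] with ε k0 k1
  have j0 : |w.1 ε (-1) - A| ≤ C0 * ε := by simpa [evalNet] using k0 () trivial
  have j1 : |deriv (w.1 ε) (-1)| ≤ C1 * ε := by simpa [evalNet, derivNet] using k1 () trivial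
  have hε : (0 : ℝ) < ε := ε.2.1
  have := mul_nonneg hC0 hε.le
  have := mul_nonneg hC1 hε.le
  constructor <;> linarith

theorem eventually_residual (T : ℝ) : ∃ C : ℝ, 0 ≤ C ∧ ∀ᶠ ε : Param in toZero, ∀ t ∈ Set.Icc (-T) T,
    |deriv (deriv (w.1 ε)) t - h.1 ε t * r.1 ε t| ≤ C * ε := by
  have e := (GenFun.mk_eq_iff_negligibleOn (derivNet (derivNet w)) (h * r)).1 hw.eq
  obtain ⟨C, hC, g⟩ := (e (Set.Icc (-T) T) isCompact_Icc).exists_nonneg 1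
  refine ⟨C, hC, g.mono fun ε hε t ht => ?_⟩
  simpa [derivNet] using hε t ht

theorem eventually_free (T : ℝ) : ∃ C : ℝ, 0 ≤ C ∧ ∀ᶠ ε : Param in toZero, ∀ t ∈ Set.Icc (-T) T,
    t ∉ Set.Ioo (-(ε : ℝ)) ε → |deriv (deriv (w.1 ε)) t| ≤ C * ε := by
  obtain ⟨C, hC, g⟩ := hw.eventually_residual T
  refine ⟨C, hC, g.mono fun ε hε t ht htn => ?_⟩
  have hz : r.1 ε t = 0 := by
    have hc := ((moderateNets_prop r).1 ε).continuous
    have hsub : closure (Set.Icc (-(ε : ℝ)) ε)ᶜ ⊆ {s | r.1 ε s = 0} :=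
      (isClosed_eq hc continuous_const).closure_subset_iff.2
        fun s hs => hw.isDeltaNet.eq_zero_of_notMem ε hs
    apply hsub
    rwa [closure_compl, interior_Icc]
  simpa [hz] using hε t ht

theorem before (T : ℝ) (hT : 1 ≤ T) : ∃ C : ℝ, 0 ≤ C ∧ ∀ᶠ ε : Param in toZero,
    ∀ t ∈ Set.Icc (-T) (-(ε : ℝ)), |deriv (w.1 ε) t| ≤ C * ε ∧ |w.1 ε t - A| ≤ C * ε := by
  obtain ⟨C, hC, g⟩ := hw.eventually_free T
  obtain ⟨C', g'⟩ := hw.eventually_initial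
  refine ⟨|C'| + C * T + (|C'| + (|C'| + C * T) * T), by positivity, ?_⟩
  filter_upwards [g, g'] with ε h1 ⟨h2, h3⟩ t ht
  have hε : (0 : ℝ) < ε := ε.2.1
  have hε1 : (ε : ℝ) < 1 := ε.2.2
  obtain ⟨k1, k2⟩ := sub_le_of_abs_deriv_deriv_le (c := -1) ((moderateNets_prop w).1 ε)
    ⟨by linarith, by linarith⟩
    (fun s hs => h1 s ⟨hs.1, by linarith [hs.2]⟩ fun hh => by linarith [hh.1, hs.2]) t ht
  have hC' : C' * ε ≤ |C'| * ε := mul_le_mul_of_nonneg_right (le_abs_self _) hε.le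
  have hlen : -(ε : ℝ) - -T ≤ T := by linarith
  have hlen0 : 0 ≤ -(ε : ℝ) - -T := by linarith [ht.1, ht.2]
  have e1 : C * ε * (-(ε : ℝ) - -T) ≤ C * ε * T := mul_le_mul_of_nonneg_left hlen (by positivity)
  have e2 : (|deriv (w.1 ε) (-1)| + C * ε * (-(ε : ℝ) - -T)) * (-(ε : ℝ) - -T) ≤
      (|C'| * ε + C * ε * T) * T := mul_le_mul (by linarith) hlen hlen0 (by positivity)
  have a1 := abs_sub_abs_le_abs_sub (deriv (w.1 ε) t) (deriv (w.1 ε) (-1))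
  have a2 := abs_sub_le (w.1 ε t) (w.1 ε (-1)) A
  have p1 : 0 ≤ |C'| * ε := by positivity
  have p2 : 0 ≤ |C'| * ε * T := by positivity
  have p3 : 0 ≤ C * ε * T := by positivity
  have p4 : 0 ≤ C * ε * T * T := by positivity
  constructor <;> linarith

theorem after (T : ℝ) : ∃ C : ℝ, 0 ≤ C ∧ ∀ᶠ ε : Param in toZero,
    ∀ t ∈ Set.Icc (ε : ℝ) T, |deriv (w.1 ε) t - deriv (w.1 ε) ε| ≤ C * ε := by
  obtain ⟨C, hC, g⟩ := hw.eventually_free |T|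
  refine ⟨C * |T|, by positivity, ?_⟩
  filter_upwards [g] with ε h1 t ht
  have hε : (0 : ℝ) < ε := ε.2.1
  have hT : T ≤ |T| := le_abs_self T
  obtain ⟨k1, -⟩ := sub_le_of_abs_deriv_deriv_le (c := ε) ((moderateNets_prop w).1 ε)
    ⟨le_rfl, ht.1.trans ht.2⟩
    (fun s hs => h1 s ⟨by linarith [hs.1, abs_nonneg T], by linarith [hs.2]⟩
      fun hh => by linarith [hh.2, hs.1]) t ht
  have := mul_le_mul_of_nonneg_left (show T - ε ≤ |T| by linarith) (show 0 ≤ C * ε by positivity)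
  linarith

/-- The total change of ẇ is bounded by sup |h| times the L¹ norm of ρ_ε, plus the residual. The
integral estimate is based at -T, so the bound at -1 is transferred through that point. -/
theorem locallyBounded_deriv : LocallyBoundedNet (derivNet w).1 := by
  intro K hK
  obtain ⟨T, hT, hKT⟩ := exists_subset_Icc hK
  obtain ⟨C, hC⟩ := hw.isDeltaNet.exists_integral_abs_le
  obtain ⟨D, hD⟩ := hw.bounded (Set.Icc (-T) T) isCompact_Icc
  obtain ⟨E, hE, g⟩ := hw.eventually_residual T
  obtain ⟨C', g'⟩ := hw.eventually_initial
  set J := |D| * |C| + E * (2 * T) with hJ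
  refine ⟨J + (J + |C'|), ?_⟩
  filter_upwards [hC, hD, g, g'] with ε h1 h2 h3 ⟨_, h4⟩ t ht
  have hε : (0 : ℝ) < ε := ε.2.1
  have hε1 : (ε : ℝ) < 1 := ε.2.2
  have hc : Continuous (r.1 ε) := ((moderateNets_prop r).1 ε).continuous
  have hint : ∫ t in (-T)..T, (|D| * |r.1 ε t| + E) ≤ J := by
    have hDr : Continuous fun t => |D| * |r.1 ε t| := continuous_const.mul hc.abs
    rw [intervalIntegral.integral_add (hDr.intervalIntegrable _ _)
      (by simp), intervalIntegral.integral_const_mul, intervalIntegral.integral_const, smul_eq_mul,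
      intervalIntegral.integral_eq_integral_of_support_subset fun t ht => ?_]
    · have := mul_le_mul_of_nonneg_left (h1.trans (le_abs_self C)) (abs_nonneg D)
      rw [hJ]
      linarith
    · have hs := hw.isDeltaNet.support_subset_Ioc ε (a := t) (by simpa using ht)
      exact ⟨by linarith [hs.1], by linarith [hs.2]⟩
  have H := sub_le_of_abs_deriv_deriv_le_integral (φ := fun t => |D| * |r.1 ε t| + E)
    ((moderateNets_prop w).1 ε) (by fun_prop) (fun s hs => by
      have a1 := abs_sub_abs_le_abs_sub (deriv (deriv (w.1 ε)) s) (h.1 ε s * r.1 ε s)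
      rw [abs_mul] at a1
      have a2 := mul_le_mul_of_nonneg_right ((h2 s hs).trans (le_abs_self D))
        (abs_nonneg (r.1 ε s))
      have a3 := mul_le_mul_of_nonneg_left hε1.le hE
      linarith [h3 s hs]) hint
  have k1 := (H t (hKT ht)).1
  have k2 := (H (-1) ⟨by linarith, by linarith⟩).1
  have a4 : C' * ε ≤ |C'| := by
    have := mul_le_mul (le_abs_self C') hε1.le hε.le (abs_nonneg C')
    linarith
  change |deriv (w.1 ε) t| ≤ _
  have b1 := abs_sub_abs_le_abs_sub (deriv (w.1 ε) t) (deriv (w.1 ε) (-T))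
  have b2 := abs_sub_abs_le_abs_sub (deriv (w.1 ε) (-T)) (deriv (w.1 ε) (-1))
  rw [abs_sub_comm (deriv (w.1 ε) (-T))] at b2
  linarith

/-- With bounded velocity, w moves only O(ε) across the impulse. -/
theorem tendsto_nearZero : Tendsto (fun q : Param × ℝ => w.1 q.1 q.2) nearZero (𝓝 A) := by
  obtain ⟨C, hC, g⟩ := hw.before 1 le_rfl
  obtain ⟨B, hB⟩ := hw.locallyBounded_deriv (Set.Icc (-1) 1) isCompact_Icc
  refine tendsto_nearZero_of_abs_sub_le (b := fun ε => (C + 2 * B) * ε)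
    (by simpa using tendsto_coe_toZero.const_mul (C + 2 * B)) ?_
  filter_upwards [g, hB] with ε h1 h2 t ht
  have hε : (0 : ℝ) < ε := ε.2.1
  have hε1 : (ε : ℝ) < 1 := ε.2.2
  rw [abs_le] at ht
  have k := (convex_Icc (-(ε : ℝ)) ε).norm_image_sub_le_of_norm_deriv_le (f := w.1 ε)
    (fun s _ => ((moderateNets_prop w).1 ε).differentiable (by simp) s)
    (fun s hs => h2 s ⟨by linarith [hs.1], by linarith [hs.2]⟩)
    (⟨le_rfl, by linarith⟩ : -(ε : ℝ) ∈ Set.Icc (-(ε : ℝ)) ε) ht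
  rw [Real.norm_eq_abs, Real.norm_eq_abs, abs_of_nonneg (by linarith [ht.1] : 0 ≤ t - -(ε : ℝ))]
    at k
  have hB0 : 0 ≤ B := (abs_nonneg _).trans (h2 0 ⟨by linarith, by linarith⟩)
  have k2 := mul_le_mul_of_nonneg_left (show t - -(ε : ℝ) ≤ 2 * ε by linarith [ht.2]) hB0
  have k3 := (h1 (-ε) ⟨by linarith, le_rfl⟩).2
  have := abs_sub_le (w.1 ε t) (w.1 ε (-ε)) A
  linarith

theorem tendsto_of_neg {t : ℝ} (ht : t < 0) :
    Tendsto (fun ε => deriv (w.1 ε) t) toZero (𝓝 0) ∧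
      Tendsto (fun ε => w.1 ε t) toZero (𝓝 A) := by
  obtain ⟨C, hC, g⟩ := hw.before (max 1 (-t)) (le_max_left _ _)
  have hz : Tendsto (fun ε : Param => C * (ε : ℝ)) toZero (𝓝 0) := by
    simpa using tendsto_coe_toZero.const_mul C
  have key : ∀ᶠ ε : Param in toZero, |deriv (w.1 ε) t| ≤ C * ε ∧ |w.1 ε t - A| ≤ C * ε := by
    filter_upwards [g, eventually_toZero_lt (neg_pos.2 ht)] with ε h1 h2
    exact h1 t ⟨by linarith [le_max_right 1 (-t)], by linarith⟩
  constructor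
  · exact squeeze_zero_norm' (key.mono fun ε h => h.1) hz
  · exact tendsto_sub_nhds_zero_iff.1 (squeeze_zero_norm' (key.mono fun ε h => h.2) hz)

/-- The jump of ẇ over [-ε, ε] is ∫ hρ up to O(ε), and the incoming velocity is O(ε). -/
theorem tendsto_kick {h₀ : ℝ} (hh : Tendsto (fun q : Param × ℝ => h.1 q.1 q.2) nearZero (𝓝 h₀)) :
    Tendsto (fun ε : Param => deriv (w.1 ε) ε) toZero (𝓝 h₀) := by
  obtain ⟨C, hC, g⟩ := hw.before 1 le_rfl
  obtain ⟨E, hE, g'⟩ := hw.eventually_residual 1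
  have hh' := hw.isDeltaNet.tendsto_integral_mul
    (fun ε => ((moderateNets_prop h).1 ε).continuous) hh
  refine (tendsto_iff_of_dist (squeeze_zero' (Eventually.of_forall fun _ => dist_nonneg)
    (g := fun ε : Param => (C + 2 * E) * (ε : ℝ)) ?_
    (by simpa using tendsto_coe_toZero.const_mul (C + 2 * E)))).1 hh'
  filter_upwards [g, g'] with ε h1 h2
  have hε : (0 : ℝ) < ε := ε.2.1
  have hε1 : (ε : ℝ) < 1 := ε.2.2
  have hd : Continuous (deriv (deriv (w.1 ε))) :=
    (contDiff_deriv_smooth (contDiff_deriv_smooth ((moderateNets_prop w).1 ε))).continuous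
  have hhr : Continuous fun t => h.1 ε t * r.1 ε t :=
    ((moderateNets_prop h).1 ε).continuous.mul ((moderateNets_prop r).1 ε).continuous
  have e1 : ∫ s in (-(ε : ℝ))..ε, deriv (deriv (w.1 ε)) s =
      deriv (w.1 ε) ε - deriv (w.1 ε) (-ε) :=
    intervalIntegral.integral_deriv_eq_sub
      (fun s _ => differentiable_deriv_of_smooth ((moderateNets_prop w).1 ε) s) (hd.intervalIntegrable _ _)
  have e2 : ∫ s in (-(ε : ℝ))..ε, h.1 ε s * r.1 ε s = ∫ s, h.1 ε s * r.1 ε s :=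
    intervalIntegral.integral_eq_integral_of_support_subset fun s hs =>
      hw.isDeltaNet.support_subset_Ioc ε (right_ne_zero_of_mul hs)
  have e3 := intervalIntegral.norm_integral_le_of_norm_le_const (a := -(ε : ℝ)) (b := ε)
    (f := fun s => deriv (deriv (w.1 ε)) s - h.1 ε s * r.1 ε s) (C := E * ε) fun s hs => by
      rw [Set.uIoc_of_le (by linarith)] at hs
      exact h2 s ⟨by linarith [hs.1], by linarith [hs.2]⟩
  rw [intervalIntegral.integral_sub (hd.intervalIntegrable _ _) (hhr.intervalIntegrable _ _),
    e1, e2, Real.norm_eq_abs, abs_of_nonneg (by linarith : (0 : ℝ) ≤ ε - -ε)] at e3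
  have e4 := (h1 (-ε) ⟨by linarith, le_rfl⟩).1
  have e5 : E * ε * (ε - -ε) ≤ 2 * E * ε := by
    have := mul_le_mul_of_nonneg_left hε1.le (show 0 ≤ 2 * E * ε by positivity)
    linarith
  rw [Real.dist_eq]
  rw [abs_le] at *
  constructor <;> linarith [e3.1, e3.2, e4.1, e4.2]

theorem tendsto_of_pos {h₀ t : ℝ}
    (hh : Tendsto (fun q : Param × ℝ => h.1 q.1 q.2) nearZero (𝓝 h₀)) (ht : 0 < t) :
    Tendsto (fun ε => deriv (w.1 ε) t) toZero (𝓝 h₀) ∧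
      Tendsto (fun ε => w.1 ε t) toZero (𝓝 (A + h₀ * t)) := by
  obtain ⟨C, hC, g⟩ := hw.after t
  have hk := hw.tendsto_kick hh
  have hz : Tendsto (fun ε : Param => C * (ε : ℝ)) toZero (𝓝 0) := by
    simpa using tendsto_coe_toZero.const_mul C
  have hA : Tendsto (fun ε : Param => w.1 ε ε) toZero (𝓝 A) :=
    hw.tendsto_nearZero.comp (f := fun ε : Param => (ε, (ε : ℝ))) (by
      rw [tendsto_def]
      intro s hs
      exact (eventually_nearZero_iff.1 hs).mono fun ε h => h ε (abs_of_pos ε.2.1).le)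
  constructor
  · refine (tendsto_iff_of_dist (squeeze_zero' (Eventually.of_forall fun _ => dist_nonneg) ?_
      hz)).1 hk
    filter_upwards [g, eventually_toZero_lt ht] with ε h1 h2
    rw [dist_comm]
    exact h1 t ⟨h2.le, le_rfl⟩
  -- After the impulse w is compared with the straight line leaving the point ε with velocity ẇ(ε).
  · have hlim : Tendsto (fun ε : Param => w.1 ε ε + deriv (w.1 ε) ε * (t - ε)) toZero
        (𝓝 (A + h₀ * t)) := by
      simpa using hA.add (hk.mul (tendsto_coe_toZero.const_sub t))
    have hz' : Tendsto (fun ε : Param => C * (ε : ℝ) * t) toZero (𝓝 0) := by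
      simpa using hz.mul_const t
    refine (tendsto_iff_of_dist (squeeze_zero' (Eventually.of_forall fun _ => dist_nonneg) ?_
      hz')).1 hlim
    filter_upwards [g, eventually_toZero_lt ht] with ε h1 h2
    have hε : (0 : ℝ) < ε := ε.2.1
    obtain ⟨ξ, hξ, hd⟩ := exists_deriv_eq_slope (w.1 ε) h2 ((moderateNets_prop w).1 ε).continuous.continuousOn
      fun s _ => (((moderateNets_prop w).1 ε).differentiable (by simp) s).differentiableWithinAt
    rw [eq_div_iff (by linarith)] at hd
    have h3 := h1 ξ ⟨hξ.1.le, hξ.2.le⟩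
    have e : w.1 ε ε + deriv (w.1 ε) ε * (t - ε) - w.1 ε t =
        -((deriv (w.1 ε) ξ - deriv (w.1 ε) ε) * (t - ε)) := by linear_combination hd
    rw [Real.dist_eq, e, abs_neg, abs_mul, abs_of_pos (by linarith : (0 : ℝ) < t - ε)]
    exact mul_le_mul h3 (by linarith) (by linarith) (by positivity)

theorem tendsto_deriv {h₀ t : ℝ}
    (hh : Tendsto (fun q : Param × ℝ => h.1 q.1 q.2) nearZero (𝓝 h₀)) (ht : t ≠ 0) :
    Tendsto (fun ε => deriv (w.1 ε) t) toZero (𝓝 (h₀ * step t)) := by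
  rcases lt_or_gt_of_ne ht with h | h
  · simpa [step, h.not_ge] using (hw.tendsto_of_neg h).1
  · simpa [step, h.le] using (hw.tendsto_of_pos hh h).1

theorem tendsto {h₀ t : ℝ}
    (hh : Tendsto (fun q : Param × ℝ => h.1 q.1 q.2) nearZero (𝓝 h₀)) (ht : t ≠ 0) :
    Tendsto (fun ε => w.1 ε t) toZero (𝓝 (A + h₀ * (step t * t))) := by
  rcases lt_or_gt_of_ne ht with h | h
  · simpa [step, h.not_ge] using (hw.tendsto_of_neg h).2
  · simpa [step, h.le] using (hw.tendsto_of_pos hh h).2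

end IsKicked

/-! ### Criteria for association -/

theorem LocallyBoundedNet.mul {u w : Param → ℝ → ℝ} (hu : LocallyBoundedNet u)
    (hw : LocallyBoundedNet w) : LocallyBoundedNet fun ε t => u ε t * w ε t := by
  intro K hK
  obtain ⟨C, hC⟩ := hu K hK
  obtain ⟨C', hC'⟩ := hw K hK
  refine ⟨C * C', ?_⟩
  filter_upwards [hC, hC'] with ε h1 h2 t ht
  rw [abs_mul]
  exact mul_le_mul (h1 t ht) (h2 t ht) (abs_nonneg _) ((abs_nonneg _).trans (h1 t ht))

theorem LocallyBoundedNet.add {u w : Param → ℝ → ℝ} (hu : LocallyBoundedNet u)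
    (hw : LocallyBoundedNet w) : LocallyBoundedNet fun ε t => u ε t + w ε t := by
  intro K hK
  obtain ⟨C, hC⟩ := hu K hK
  obtain ⟨C', hC'⟩ := hw K hK
  refine ⟨C + C', ?_⟩
  filter_upwards [hC, hC'] with ε h1 h2 t ht
  exact (abs_add_le _ _).trans (add_le_add (h1 t ht) (h2 t ht))

theorem locallyBoundedNet_constNet (f : SmoothLine) : LocallyBoundedNet (constNet f).1 := by
  intro K hK
  obtain ⟨B, hB⟩ := hK.exists_bound_of_continuousOn f.2.continuous.continuousOn
  exact ⟨B, Eventually.of_forall fun _ t ht => hB t ht⟩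

theorem integrable_mul_testFunction {g : ℝ → ℝ} (hg : LocallyIntegrable g)
    (φ : 𝓓((⊤ : TopologicalSpace.Opens ℝ), ℝ)) : Integrable fun t => g t * φ t := by
  simpa using hg.integrable_smul_right_of_hasCompactSupport φ.continuous φ.hasCompactSupport

/-- Dominated convergence on the support of φ; the point 0, where the limit may fail, is a null set.
-/
theorem tendsto_integral_mul_testFunction {u : Param → ℝ → ℝ} (hc : ∀ ε, Continuous (u ε))
    (hb : LocallyBoundedNet u) {g : ℝ → ℝ}
    (h : ∀ t, t ≠ 0 → Tendsto (fun ε => u ε t) toZero (𝓝 (g t)))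
    (φ : 𝓓((⊤ : TopologicalSpace.Opens ℝ), ℝ)) :
    Tendsto (fun ε : Param => ∫ t, u ε t * φ t) toZero (𝓝 (∫ t, g t * φ t)) := by
  obtain ⟨C, hC⟩ := hb (tsupport φ) φ.hasCompactSupport
  refine tendsto_integral_filter_of_dominated_convergence (fun t => C * |φ t|)
    (Eventually.of_forall fun ε => ((hc ε).mul φ.continuous).aestronglyMeasurable) ?_ ?_ ?_
  · refine hC.mono fun ε hε => Eventually.of_forall fun t => ?_
    rw [Real.norm_eq_abs, abs_mul]
    by_cases ht : t ∈ tsupport φ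
    · exact mul_le_mul_of_nonneg_right (hε t ht) (abs_nonneg _)
    · simp [image_eq_zero_of_notMem_tsupport ht]
  · exact ((φ.continuous.integrable_of_hasCompactSupport φ.hasCompactSupport).abs).const_mul C
  · have : ∀ᵐ t : ℝ, t ≠ 0 := by
      rw [ae_iff]; simp
    exact this.mono fun t ht => (h t ht).mul_const _

/-- One representative suffices: the difference from any other is locally bounded and tends to 0
pointwise. -/
theorem assoc_mk {u : moderateNets} {T : Distr}
    (h : ∀ φ : 𝓓((⊤ : TopologicalSpace.Opens ℝ), ℝ),
      Tendsto (fun ε : Param => ∫ t, u.1 ε t * φ t) toZero (𝓝 (T φ))) :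
    Assoc (GenFun.mk u) T := by
  intro w hw φ
  rw [GenFun.mk_eq_iff_negligibleOn] at hw
  have hcu := fun ε => ((moderateNets_prop u).1 ε).continuous
  have hcw := fun ε => ((moderateNets_prop w).1 ε).continuous
  have hcd : ∀ ε, Continuous fun t => w.1 ε t - u.1 ε t := fun ε => (hcw ε).sub (hcu ε)
  have hd := tendsto_integral_mul_testFunction (u := fun ε t => w.1 ε t - u.1 ε t)
    (g := fun _ => 0) hcd
    (fun K hK => by
      obtain ⟨C, hC⟩ := hw K hK 0
      exact ⟨C, by simpa using hC⟩)
    (fun t _ => by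
      obtain ⟨C, hC⟩ := hw {t} isCompact_singleton 1
      refine squeeze_zero_norm' (a := fun ε : Param => C * (ε : ℝ)) (hC.mono fun ε hε => ?_)
        (by simpa using tendsto_coe_toZero.const_mul C)
      simpa using hε t rfl) φ
  have := (h φ).add hd
  simp only [zero_mul, integral_zero, add_zero] at this
  refine this.congr fun ε => ?_
  rw [← integral_add (integrable_mul_testFunction (hcu ε).locallyIntegrable φ)
    (integrable_mul_testFunction (hcd ε).locallyIntegrable φ)]
  congr 1
  funext t
  ring

theorem Assoc.add {g h : GenFun} {S T : Distr} (hg : Assoc g S) (hh : Assoc h T) :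
    Assoc (g + h) (S + T) := by
  obtain ⟨u, rfl⟩ := g.exists_rep
  obtain ⟨w, rfl⟩ := h.exists_rep
  refine assoc_mk (u := u + w) fun φ => ?_
  have hcu := fun ε => ((moderateNets_prop u).1 ε).continuous
  have hcw := fun ε => ((moderateNets_prop w).1 ε).continuous
  refine ((hg u rfl φ).add (hh w rfl φ)).congr fun ε => ?_
  rw [← integral_add (integrable_mul_testFunction (hcu ε).locallyIntegrable φ)
    (integrable_mul_testFunction (hcw ε).locallyIntegrable φ)]
  congr 1
  funext t
  exact (add_mul _ _ _).symm

/-- The distribution `T` is given by the locally integrable function `g`. -/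
structure IsRegular (T : Distr) (g : ℝ → ℝ) : Prop where
  locallyIntegrable : LocallyIntegrable g
  apply_eq : ∀ φ : 𝓓((⊤ : TopologicalSpace.Opens ℝ), ℝ), T φ = ∫ t, g t * φ t

theorem isRegular_regularDistr (g : ℝ → ℝ) (hg : LocallyIntegrable g) :
    IsRegular (regularDistr g hg) g :=
  ⟨hg, fun _ => rfl⟩

theorem IsRegular.add {S T : Distr} {g h : ℝ → ℝ} (hS : IsRegular S g) (hT : IsRegular T h) :
    IsRegular (S + T) fun t => g t + h t := by
  refine ⟨hS.1.add hT.1, fun φ => ?_⟩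
  change S φ + T φ = _
  rw [hS.2, hT.2, ← integral_add (integrable_mul_testFunction hS.1 φ)
    (integrable_mul_testFunction hT.1 φ)]
  simp only [add_mul]

theorem IsRegular.smul {T : Distr} {g : ℝ → ℝ} (hT : IsRegular T g) (c : ℝ) :
    IsRegular (c • T) fun t => c * g t := by
  refine ⟨hT.1.smul c, fun φ => ?_⟩
  change c * T φ = _
  rw [hT.2, ← integral_const_mul]
  simp only [mul_assoc]

theorem isRegular_theta : IsRegular thetaDistr step := isRegular_regularDistr _ _

theorem isRegular_kink : IsRegular kinkDistr fun t => step t * t := isRegular_regularDistr _ _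

theorem isRegular_one : IsRegular oneDistr fun _ => 1 := isRegular_regularDistr _ _

theorem isRegular_id : IsRegular idDistr fun t => t := isRegular_regularDistr _ _

theorem assoc_of_tendsto {u : moderateNets} (hb : LocallyBoundedNet u.1) {T : Distr} {g : ℝ → ℝ}
    (hT : IsRegular T g) (h : ∀ t, t ≠ 0 → Tendsto (fun ε => u.1 ε t) toZero (𝓝 (g t))) :
    Assoc (GenFun.mk u) T := by
  refine assoc_mk fun φ => ?_
  rw [hT.apply_eq]
  exact tendsto_integral_mul_testFunction
    (fun ε => ((moderateNets_prop u).1 ε).continuous) hb h φ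

/-- Only the behaviour of h on the shrinking support matters, where hφ tends to h₀ φ(0). -/
theorem IsDeltaNet.assoc_mul {r : moderateNets} (hr : IsDeltaNet r) {h : moderateNets} {h₀ : ℝ}
    (hh : Tendsto (fun q : Param × ℝ => h.1 q.1 q.2) nearZero (𝓝 h₀)) :
    Assoc (GenFun.mk (h * r)) (h₀ • diracDistr) := by
  refine assoc_mk fun φ => ?_
  have hφ : Tendsto (fun q : Param × ℝ => φ q.2) nearZero (𝓝 (φ 0)) :=
    (φ.continuous.tendsto 0).comp tendsto_snd_nearZero
  have := hr.tendsto_integral_mul (H := fun ε t => h.1 ε t * φ t)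
    (fun ε => ((moderateNets_prop h).1 ε).continuous.mul φ.continuous) (hh.mul hφ)
  refine this.congr fun ε => ?_
  congr 1
  funext t
  change h.1 ε t * φ t * r.1 ε t = h.1 ε t * r.1 ε t * φ t
  ring

/-- Needed for the limits of ẋ² and Pẋ, which are products of pointwise limits. -/
theorem step_mul_step (t : ℝ) : step t * step t = step t := by
  by_cases h : 0 ≤ t <;> simp [step, h]

/-- Real initial data make m bounded in the a priori estimate. The conclusion lets cP be regarded as
a bounded coefficient of ρ. -/
theorem IsDeltaNet.locallyBounded_of_impulsive {r : moderateNets} (hr : IsDeltaNet r)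
    {c p : moderateNets} (hc : LocallyBoundedNet c.1)
    (hp : GenFun.D (GenFun.D (GenFun.mk p)) = GenFun.mk c * GenFun.mk r * GenFun.mk p) {a b : ℝ}
    (h0 : (GenFun.mk p).at (-1) = algebraMap ℝ GenNum a)
    (h1 : (GenFun.D (GenFun.mk p)).at (-1) = algebraMap ℝ GenNum b) :
    LocallyBoundedNet p.1 := by
  intro K hK
  obtain ⟨T, hT, hKT⟩ := exists_subset_Icc hK
  obtain ⟨D, hD⟩ := hc (Set.Icc (-T) T) isCompact_Icc
  obtain ⟨B, hB, H⟩ := hr.exists_bound T D hT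
  have e := (GenFun.mk_eq_iff_negligibleOn (derivNet (derivNet p)) (c * r * p)).1 hp
  have e0 := (GenNum.mk_eq_iff (evalNet (-1) p) (algebraMap ℝ moderateNumbers a)).1 h0
  have e1 := (GenNum.mk_eq_iff (evalNet (-1) (derivNet p)) (algebraMap ℝ moderateNumbers b)).1 h1
  obtain ⟨C0, hC0, g0⟩ := e0.exists_nonneg 0
  obtain ⟨C1, hC1, g1⟩ := e1.exists_nonneg 0
  obtain ⟨C2, hC2, g2⟩ := (e _ (isCompact_Icc (a := -T) (b := T))).exists_nonneg 0
  refine ⟨B * (|a| + |b| + C0 + C1 + C2), ?_⟩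
  filter_upwards [hD, H, g0, g1, g2] with ε hDε Hε k0 k1 k2 t ht
  have j0 : |p.1 ε (-1) - a| ≤ C0 := by simpa [evalNet] using k0 () trivial
  have j1 : |deriv (p.1 ε) (-1) - b| ≤ C1 := by simpa [evalNet, derivNet] using k1 () trivial
  have l0 := abs_sub_abs_le_abs_sub (p.1 ε (-1)) a
  have l1 := abs_sub_abs_le_abs_sub (deriv (p.1 ε) (-1)) b
  have n0 := abs_nonneg a
  have n1 := abs_nonneg b
  refine (Hε (p.1 ε) _ ((moderateNets_prop p).1 ε) (by linarith) (by linarith)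
    (fun s hs => ?_) t (hKT ht)).1
  have j2 : |deriv (deriv (p.1 ε)) s - c.1 ε s * r.1 ε s * p.1 ε s| ≤ C2 := by
    simpa [derivNet] using k2 s hs
  have l2 := abs_sub_abs_le_abs_sub (deriv (deriv (p.1 ε)) s) (c.1 ε s * r.1 ε s * p.1 ε s)
  rw [abs_mul, abs_mul] at l2
  have := mul_le_mul_of_nonneg_right (mul_le_mul_of_nonneg_right (hDε s hs)
    (abs_nonneg (r.1 ε s))) (abs_nonneg (p.1 ε s))
  linarith

/-! ### The Jacobi equation -/

/-- Half of a smooth function. -/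
noncomputable def SmoothLine.halved (f : SmoothLine) : SmoothLine :=
  ⟨fun s => 1 / 2 * f.1 s, contDiff_const.mul f.2⟩

theorem SmoothLine.mk_halved (f : SmoothLine) (x : LBGenFun) :
    GenFun.mk (lineCompNet f.halved x.rep x.bounded_rep) = GenFun.half * f.comp x := rfl

theorem locallyBounded_lineCompNet (f : SmoothLine) (x : LBGenFun) :
    LocallyBoundedNet (lineCompNet f x.rep x.bounded_rep).1 :=
  locallyBoundedNet_comp f x.bounded_rep

-- Every correction term, and every term of its derivative, carries a factor ẋ, ẍ, ρ or ρ̇, all zero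
-- at -1.
open GenFun in
theorem hasInitialData_iff {f : SmoothLine} {r : moderateNets} (hr : IsDeltaNet r) {x : LBGenFun}
    (hx : D (D x.1) = half * (f.d.comp x * GenFun.mk r)) (hx' : (D x.1).at (-1) = 0)
    {N : Fin 4 → GenFun} {n n' : Fin 4 → GenNum} :
    HasInitialData N n n' ↔ ((N 0).at (-1) = n 0 ∧ (D (N 0)).at (-1) = n' 0) ∧
      ((N 1 - (2 * (N 2 - D x.1 * N 0) * D x.1 + D x.1 ^ 2 * N 0 +
        N 0 * f.comp x * GenFun.mk r)).at (-1) = n 1 ∧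
      (D (N 1 - (2 * (N 2 - D x.1 * N 0) * D x.1 + D x.1 ^ 2 * N 0 +
        N 0 * f.comp x * GenFun.mk r))).at (-1) = n' 1) ∧
      ((N 2 - D x.1 * N 0).at (-1) = n 2 ∧ (D (N 2 - D x.1 * N 0)).at (-1) = n' 2) ∧
      ((N 3).at (-1) = n 3 ∧ (D (N 3)).at (-1) = n' 3) := by
  have e0 := hr.at_neg_one
  have e1 := hr.at_D_neg_one
  have e2 : (D (D x.1)).at (-1) = 0 := by rw [hx, at_mul, at_mul, e0, mul_zero, mul_zero]
  simp only [HasInitialData, Fin.forall_fin_succ, pow_two, D_sub, D_add,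
    D_mul, at_sub, at_add, at_mul, hx', e0, e1, e2, mul_zero, zero_mul, add_zero, sub_zero]
  simp

open GenFun in
theorem existsUnique_isJacobiField {f : SmoothLine} {r : moderateNets} (hr : IsDeltaNet r)
    {x : LBGenFun} (hx : D (D x.1) = half * (f.d.comp x * GenFun.mk r))
    (hx' : (D x.1).at (-1) = 0) (n n' : Fin 4 → GenNum) :
    ∃! N : Fin 4 → GenFun, IsJacobiField f (GenFun.mk r) x N ∧ HasInitialData N n n' := by
  have hc := locallyBounded_lineCompNet f.d.d.halved x
  obtain ⟨N0, h0, i0⟩ := hr.exists_D_D_eq_zero (n 0) (n' 0)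
  obtain ⟨W, h1, i1⟩ := hr.exists_D_D_eq_zero (n 1) (n' 1)
  obtain ⟨P, h2, i2⟩ := hr.exists_solution _ hc (n 2) (n' 2)
  obtain ⟨N3, h3, i3⟩ := hr.exists_D_D_eq_zero (n 3) (n' 3)
  -- The triangular substitution solved for N.
  refine ⟨![N0, W + (2 * P * D x.1 + D x.1 ^ 2 * N0 + N0 * f.comp x * GenFun.mk r),
    P + D x.1 * N0, N3], ⟨(isJacobiField_iff hx).2 ?_, (hasInitialData_iff hr hx hx').2 ?_⟩, ?_⟩
  · simp only [Matrix.cons_val, add_sub_cancel_right]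
    exact ⟨h0, h3, h2, h1⟩
  · simp only [Matrix.cons_val, add_sub_cancel_right]
    exact ⟨i0, i1, i2, i3⟩
  · rintro N ⟨hN, hNi⟩
    obtain ⟨k0, k3, k2, k1⟩ := (isJacobiField_iff hx).1 hN
    obtain ⟨j0, j1, j2, j3⟩ := (hasInitialData_iff hr hx hx').1 hNi
    have q0 := hr.eq_of_D_D_eq_zero k0 h0 (j0.1.trans i0.1.symm) (j0.2.trans i0.2.symm)
    have q3 := hr.eq_of_D_D_eq_zero k3 h3 (j3.1.trans i3.1.symm) (j3.2.trans i3.2.symm)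
    have q2 := hr.eq_of_impulsive _ hc k2 h2 (j2.1.trans i2.1.symm) (j2.2.trans i2.2.symm)
    have q1 := hr.eq_of_D_D_eq_zero k1 h1 (j1.1.trans i1.1.symm) (j1.2.trans i1.2.symm)
    rw [q2] at q1
    funext i
    fin_cases i
    · exact q0
    · change N 1 = _
      rw [sub_eq_iff_eq_add.1 q1, q0]
      rfl
    · change N 2 = _
      rw [sub_eq_iff_eq_add.1 q2, q0]
      rfl
    · exact q3

/-! ### Association relations for the two choices of initial data -/

section Association

variable {f : SmoothLine} {r : moderateNets} {x : LBGenFun} {x₀ : ℝ}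

theorem isKicked_rep (hr : IsDeltaNet r)
    (hx : GenFun.D (GenFun.D x.1) = GenFun.half * (f.d.comp x * GenFun.mk r))
    (hx₀ : x.1.at (-1) = algebraMap ℝ GenNum x₀) (hx' : (GenFun.D x.1).at (-1) = 0) :
    IsKicked r (lineCompNet f.d.halved x.rep x.bounded_rep) x.rep x₀ := by
  refine ⟨hr, locallyBounded_lineCompNet _ x, ?_, ?_, ?_⟩
  · rw [SmoothLine.mk_halved, x.mk_rep, hx, mul_assoc]
  · rw [x.mk_rep, hx₀]
  · rw [x.mk_rep, hx']

theorem tendsto_lineCompNet (g : SmoothLine) {h : moderateNets}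
    (hk : IsKicked r h x.rep x₀) :
    Tendsto (fun q : Param × ℝ => (lineCompNet g x.rep x.bounded_rep).1 q.1 q.2) nearZero
      (𝓝 (g.1 x₀)) :=
  (g.2.continuous.tendsto x₀).comp hk.tendsto_nearZero

/-- The generalized function `t ↦ a + b (1 + t)`. -/
abbrev affineGenFun (a b : ℝ) : GenFun := GenFun.mk (constNet (affineLine a b))

-- P vanishes and N^u = a(1+u), so the solution is explicit in x, ẋ and ρ. The factor 1+u turns θ
-- into θ + u_+ and equals 1 where δ sits.
open GenFun in
theorem assoc_of_initial_velocity (hr : IsDeltaNet r)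
    (hx : D (D x.1) = half * (f.d.comp x * GenFun.mk r))
    (hx₀ : x.1.at (-1) = algebraMap ℝ GenNum x₀) (hx' : (D x.1).at (-1) = 0)
    (a b : ℝ) (N : Fin 4 → GenFun) (hN : IsJacobiField f (GenFun.mk r) x N)
    (hNi : HasInitialData N (constVec ![0, 0, 0, 0]) (constVec ![a, b, 0, 0])) :
    Assoc (N 2) ((1 / 2 * a * f.d.1 x₀) • (kinkDistr + thetaDistr)) ∧
      Assoc (N 1) (b • (oneDistr + idDistr) +
        a • (f.1 x₀ • diracDistr +
          (1 / 4 * f.d.1 x₀ ^ 2) • (thetaDistr + kinkDistr))) := by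
  obtain ⟨k0, k3, k2, k1⟩ := (isJacobiField_iff hx).1 hN
  obtain ⟨j0, j1, j2, j3⟩ := (hasInitialData_iff hr hx hx').1 hNi
  have hk := isKicked_rep hr hx hx₀ hx'
  have hX := tendsto_lineCompNet f.d.halved hk
  have hb : LocallyBoundedNet (derivNet x.rep).1 := hk.locallyBounded_deriv
  have eX : D x.1 = GenFun.mk (derivNet x.rep) := by rw [← D_mk, x.mk_rep]
  have q0 : N 0 = affineGenFun 0 a := hr.eq_of_D_D_eq_zero k0 (D_D_affine 0 a)
    (j0.1.trans (at_affine 0 a).symm) (j0.2.trans (at_D_affine 0 a).symm)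
  have q2 : N 2 - D x.1 * N 0 = 0 :=
    hr.eq_zero_of_impulsive _ (locallyBounded_lineCompNet f.d.d.halved x) _ k2
      (j2.1.trans (map_zero _)) (j2.2.trans (map_zero _))
  rw [q2, mul_zero, zero_mul, zero_add] at k1 j1
  have q1 := hr.eq_of_D_D_eq_zero k1 (D_D_affine 0 b)
    (j1.1.trans (at_affine 0 b).symm) (j1.2.trans (at_D_affine 0 b).symm)
  have e2 : N 2 = GenFun.mk (derivNet x.rep * constNet (affineLine 0 a)) := by
    rw [sub_eq_zero.1 q2, q0, eX]
    rfl
  have e1 : N 1 = GenFun.mk (constNet (affineLine 0 b)) +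
      (GenFun.mk (derivNet x.rep * derivNet x.rep * constNet (affineLine 0 a)) +
        GenFun.mk (constNet (affineLine 0 a) * lineCompNet f x.rep x.bounded_rep * r)) := by
    rw [sub_eq_iff_eq_add.1 q1, q0, eX, pow_two]
    rfl
  have hA := locallyBoundedNet_constNet (affineLine 0 a)
  constructor
  · rw [e2]
    refine assoc_of_tendsto (hb.mul hA) ((isRegular_kink.add isRegular_theta).smul _) fun t ht => ?_
    have := (hk.tendsto_deriv hX ht).mul_const ((affineLine 0 a).1 t)
    have e : 1 / 2 * a * f.d.1 x₀ * (step t * t + step t) =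
        f.d.halved.1 x₀ * step t * (affineLine 0 a).1 t := by
      simp only [SmoothLine.halved, affineLine]
      ring
    rw [e]
    exact this
  · have s1 : Assoc (GenFun.mk (constNet (affineLine 0 b))) (b • (oneDistr + idDistr)) :=
      assoc_of_tendsto (locallyBoundedNet_constNet _) ((isRegular_one.add isRegular_id).smul b)
        fun t _ => by
          have e : b * (1 + t) = (affineLine 0 b).1 t := (zero_add _).symm
          rw [e]
          exact tendsto_const_nhds
    have s2 : Assoc (GenFun.mk (derivNet x.rep * derivNet x.rep * constNet (affineLine 0 a)))
        ((1 / 4 * f.d.1 x₀ ^ 2 * a) • (thetaDistr + kinkDistr)) := by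
      refine assoc_of_tendsto ((hb.mul hb).mul hA)
        ((isRegular_theta.add isRegular_kink).smul _) fun t ht => ?_
      have l := hk.tendsto_deriv hX ht
      have := (l.mul l).mul_const ((affineLine 0 a).1 t)
      have e : 1 / 4 * f.d.1 x₀ ^ 2 * a * (step t + step t * t) =
          f.d.halved.1 x₀ * step t * (f.d.halved.1 x₀ * step t) * (affineLine 0 a).1 t := by
        simp only [SmoothLine.halved, affineLine]
        linear_combination (-(1 / 4 * f.d.1 x₀ ^ 2 * a * (1 + t))) * step_mul_step t
      rw [e]
      exact this
    have s3 : Assoc (GenFun.mk (constNet (affineLine 0 a) * lineCompNet f x.rep x.bounded_rep * r))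
        ((a * f.1 x₀) • diracDistr) := by
      refine hr.assoc_mul ?_
      have l : Tendsto (fun q : Param × ℝ => (affineLine 0 a).1 q.2) nearZero (𝓝 a) := by
        have := ((affineLine 0 a).2.continuous.tendsto 0).comp tendsto_snd_nearZero
        have e : (affineLine 0 a).1 0 = a := by simp [affineLine]
        rwa [e] at this
      exact l.mul (tendsto_lineCompNet f hk)
    have e : b • (oneDistr + idDistr) + a • (f.1 x₀ • diracDistr +
          (1 / 4 * f.d.1 x₀ ^ 2) • (thetaDistr + kinkDistr)) = b • (oneDistr + idDistr) +
        ((1 / 4 * f.d.1 x₀ ^ 2 * a) • (thetaDistr + kinkDistr) + (a * f.1 x₀) • diracDistr) := by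
      module
    rw [e1, e]
    exact s1.add (s2.add s3)

open GenFun in
theorem assoc_of_initial_displacement (hr : IsDeltaNet r)
    (hx : D (D x.1) = half * (f.d.comp x * GenFun.mk r))
    (hx₀ : x.1.at (-1) = algebraMap ℝ GenNum x₀) (hx' : (D x.1).at (-1) = 0)
    (a : ℝ) (N : Fin 4 → GenFun) (hN : IsJacobiField f (GenFun.mk r) x N)
    (hNi : HasInitialData N (constVec ![0, 0, a, 0]) (constVec ![0, 0, 0, 0])) :
    Assoc (N 2) (a • (oneDistr + (1 / 2 * f.d.d.1 x₀) • kinkDistr)) ∧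
      Assoc (N 1) ((a * f.d.1 x₀) • (thetaDistr + (1 / 2 * f.d.d.1 x₀) • kinkDistr)) := by
  obtain ⟨k0, k3, k2, k1⟩ := (isJacobiField_iff hx).1 hN
  obtain ⟨j0, j1, j2, j3⟩ := (hasInitialData_iff hr hx hx').1 hNi
  have hk := isKicked_rep hr hx hx₀ hx'
  have hX := tendsto_lineCompNet f.d.halved hk
  have hb : LocallyBoundedNet (derivNet x.rep).1 := hk.locallyBounded_deriv
  have eX : D x.1 = GenFun.mk (derivNet x.rep) := by rw [← D_mk, x.mk_rep]
  have q0 : N 0 = 0 := hr.eq_of_D_D_eq_zero k0 (by rw [D_zero, D_zero])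
    (j0.1.trans (map_zero _)) (by rw [j0.2, D_zero]; exact map_zero _)
  rw [q0, mul_zero, sub_zero] at k2 j2 k1 j1
  rw [mul_zero, zero_mul, zero_mul, add_zero, add_zero] at k1 j1
  have q1 : N 1 - 2 * N 2 * D x.1 = 0 := hr.eq_of_D_D_eq_zero k1 (by rw [D_zero, D_zero])
    (j1.1.trans (map_zero _)) (by rw [j1.2, D_zero]; exact map_zero _)
  obtain ⟨p, hp⟩ := (N 2).exists_rep
  rw [← hp] at k2 j2 q1 ⊢
  have hc := locallyBounded_lineCompNet f.d.d.halved x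
  have hpb : LocallyBoundedNet p.1 := hr.locallyBounded_of_impulsive hc k2 j2.1 j2.2
  -- Once P is known to be bounded, ½ f''(x) P is an admissible h, with limit ½ f''(x₀) a at the
  -- impulse.
  have hkp : IsKicked r (lineCompNet f.d.d.halved x.rep x.bounded_rep * p) p a := by
    refine ⟨hr, hc.mul hpb, ?_, j2.1, j2.2.trans (map_zero _)⟩
    rw [k2, ← SmoothLine.mk_halved]
    exact mul_right_comm (GenFun.mk _) (GenFun.mk r) (GenFun.mk p)
  have hP := (tendsto_lineCompNet f.d.d.halved hk).mul hkp.tendsto_nearZero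
  have lp : ∀ t, t ≠ 0 → Tendsto (fun ε => p.1 ε t) toZero
      (𝓝 (a + f.d.d.halved.1 x₀ * a * (step t * t))) := fun t ht => hkp.tendsto hP ht
  constructor
  · refine assoc_of_tendsto hpb ((isRegular_one.add (isRegular_kink.smul _)).smul _) fun t ht => ?_
    have e : a * (1 + 1 / 2 * f.d.d.1 x₀ * (step t * t)) =
        a + f.d.d.halved.1 x₀ * a * (step t * t) := by
      simp only [SmoothLine.halved]
      ring
    rw [e]
    exact lp t ht
  -- No δ term arises: N^v = 2Pẋ is locally bounded.
  · have e1 : N 1 = GenFun.mk (p * derivNet x.rep + p * derivNet x.rep) := by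
      rw [sub_eq_zero.1 q1, eX, mul_assoc, two_mul]
      rfl
    rw [e1]
    refine assoc_of_tendsto ((hpb.mul hb).add (hpb.mul hb))
      ((isRegular_theta.add (isRegular_kink.smul _)).smul _) fun t ht => ?_
    have l := (lp t ht).mul (hk.tendsto_deriv hX ht)
    have e : a * f.d.1 x₀ * (step t + 1 / 2 * f.d.d.1 x₀ * (step t * t)) =
        (a + f.d.d.halved.1 x₀ * a * (step t * t)) * (f.d.halved.1 x₀ * step t) +
        (a + f.d.d.halved.1 x₀ * a * (step t * t)) * (f.d.halved.1 x₀ * step t) := by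
      simp only [SmoothLine.halved]
      linear_combination (-(1 / 2 * a * f.d.1 x₀ * f.d.d.1 x₀ * t)) * step_mul_step t
    rw [e]
    exact l.add l

end Association

end Colombeau

theorem theorem2 (F : SmoothPlane) (hF : F.IsAxisymmetric)
    (ρ : GenFun) (hρ : IsGeneralizedDelta ρ)
    -- the geodesic, in the hypersurface y = 0, with initial data at u = -1
    (x₀ v₁ : ℝ) (v x y : LBGenFun) (hγ : IsGeodesic F ρ v x y)
    (hv : v.1.at (-1) = 0) (hv' : (GenFun.D v.1).at (-1) = algebraMap ℝ GenNum v₁)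
    (hx : x.1.at (-1) = algebraMap ℝ GenNum x₀) (hx' : (GenFun.D x.1).at (-1) = 0)
    (hy : y.1.at (-1) = 0) (hy' : (GenFun.D y.1).at (-1) = 0) :
    -- existence and uniqueness
    (∀ n n' : Fin 4 → GenNum,
      ∃! N : Fin 4 → GenFun, IsJacobiField F.profile ρ x N ∧ HasInitialData N n n') ∧
    -- association relations for the first choice of initial data
    (∀ (a b : ℝ) (N : Fin 4 → GenFun), IsJacobiField F.profile ρ x N →
      HasInitialData N (constVec ![0, 0, 0, 0]) (constVec ![a, b, 0, 0]) →
      Assoc (N 2) ((1 / 2 * a * F.profile.d.1 x₀) • (kinkDistr + thetaDistr)) ∧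
      Assoc (N 1) (b • (oneDistr + idDistr) +
        a • (F.profile.1 x₀ • diracDistr +
          (1 / 4 * F.profile.d.1 x₀ ^ 2) • (thetaDistr + kinkDistr)))) ∧
    -- association relations for the second choice of initial data
    (∀ (a : ℝ) (N : Fin 4 → GenFun), IsJacobiField F.profile ρ x N →
      HasInitialData N (constVec ![0, 0, a, 0]) (constVec ![0, 0, 0, 0]) →
      Assoc (N 2) (a • (oneDistr + (1 / 2 * F.profile.d.d.1 x₀) • kinkDistr)) ∧
      Assoc (N 1) ((a * F.profile.d.1 x₀) •
        (thetaDistr + (1 / 2 * F.profile.d.d.1 x₀) • kinkDistr))) := by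
  obtain ⟨r, rfl, hs, hi, hC⟩ := hρ
  have hr : IsDeltaNet r := ⟨hs, hi, hC⟩
  have hode := hγ.eq_x_of_y_eq_zero (hγ.y_eq_zero hF hr hy hy')
  exact ⟨existsUnique_isJacobiField hr hode hx', assoc_of_initial_velocity hr hode hx hx',
    assoc_of_initial_displacement hr hode hx hx'⟩
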